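/- All graphs are finite and simple; $\alpha(G)$ is the independence number and $\chi(G)$ the chromatic number of $G$. For a graph $H$, an *$H$-model* in $G$ is a family $(T_v)_{v\in V(H)}$ of pairwise vertex-disjoint subgraphs of $G$, each of which is a tree (called a branch set), together with a set of linking edges of $G$, each joining $T_u$ to $T_v$ for some edge $uv$ of $H$, and containing at least one such edge for every edge $uv$ of $H$. The model is *odd* if its vertices can be coloured with two colours so that every edge of each tree $T_v$ has ends of different colours and every linking edge has ends of the same colour. It is a *special* odd model if such a colouring can be chosen in which moreover all branch sets that consist of a single vertex have the same colour. **Theorem.** Let $G$ be a graph with $\alpha(G)=2$. For every positive integer $\ell$ with $\ell<\chi(G)$, the graph $G$ contains a special odd model of the complete bipartite graph $K_{\ell,\chi(G)-\ell}$. -/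

import Mathlib

namespace SimpleGraph

/-- An `H`-model in `G`: a family of vertex-disjoint subgraphs of `G`, indexed by the vertices
of `H`, each of which is a tree (a branch set), such that every edge `uv` of `H` is realised by
at least one edge of `G` between the branch sets of `u` and `v`. The model, as a subgraph of `G`,
consists of the branch sets and of the selected linking edges `link`, at least one for each edge
of `H`. -/
structure Model {V W : Type*} (H : SimpleGraph W) (G : SimpleGraph V) where
  /-- the branch set of a vertex of `H` -/
  branch : W → G.Subgraph
  isTree : ∀ w, (branch w).coe.IsTree
  disjoint : ∀ u v, u ≠ v → Disjoint (branch u).verts (branch v).verts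
  /-- the linking edges, as a spanning subgraph of `G` -/
  link : SimpleGraph V
  link_le : link ≤ G
  /-- the linking edges are edges between two branch sets that correspond to an edge of `H` -/
  link_between : ∀ x y, link.Adj x y →
    ∃ u v, H.Adj u v ∧ x ∈ (branch u).verts ∧ y ∈ (branch v).verts
  exists_link : ∀ u v, H.Adj u v →
    ∃ x ∈ (branch u).verts, ∃ y ∈ (branch v).verts, link.Adj x y

/-- A 2-colouring `c` witnesses that the model `M` is odd: every edge of a branch set is
bichromatic, and every linking edge of the model is monochromatic. (Only the colours of the
vertices of the model matter.) -/
def Model.IsOddColoring {V W : Type*} {H : SimpleGraph W} {G : SimpleGraph V}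
    (M : Model H G) (c : V → Fin 2) : Prop :=
  (∀ w x y, (M.branch w).Adj x y → c x ≠ c y) ∧ ∀ x y, M.link.Adj x y → c x = c y

/-- `M` is a special odd model: some 2-colouring witnesses that `M` is odd and gives all
branch sets that consist of a single vertex the same colour. -/
def Model.IsSpecialOdd {V W : Type*} {H : SimpleGraph W} {G : SimpleGraph V}
    (M : Model H G) : Prop :=
  ∃ c : V → Fin 2, M.IsOddColoring c ∧
    ∃ a : Fin 2, ∀ w x, (M.branch w).verts = {x} → c x = a

end SimpleGraph

set_option linter.unusedSectionVars false

namespace SimpleGraph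

variable {V : Type*} [DecidableEq V] {G : SimpleGraph V}

/-! The model is built from single vertices and seagulls only. Colour the ends of every piece with
one colour and the middles of the seagulls with the other, and use linking edges between ends only:
the model is then special and odd. Since there is no independent triple, the two ends of a seagull
dominate all other vertices, so a seagull is linked to every piece disjoint from it. Only pairs of
single vertices on opposite sides need care, and `HasModel.of_clique` handles these with a clique
`K` and a set `Z` complete to it.

A matching of size `m` in the complement gives a colouring with `|V| - m` colours, so `ℓ + r = χ`
satisfies `ℓ + r + m ≤ |V|` for every such matching. `HasModel.of_antimatching` uses only this
inequality, by induction on the vertex set. If deleting some vertex keeps it, delete that vertex.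
Otherwise every vertex is missed by a maximum matching of the complement. By Gallai's lemma, either
the vertex set splits into two parts complete to each other, whose models are joined, or a maximum
matching misses at most one vertex. In the latter case there are at least `2 (ℓ + r) - 1` vertices,
the situation of `HasModel.of_card`.

There, with `ℓ ≤ r`, take a packing of fewer than `ℓ` seagulls and a vertex `w` outside it. The
nonneighbours of `w` form a clique `C`, and the packing is chosen to cover as much of `C` as
possible. If few vertices of `C` stay uncovered, then `w` has many uncovered neighbours, and these
with `w` and the seagulls suffice. If `C` is large, it suffices alone. Otherwise some seagull has at
most one vertex in `C`, and optimality becomes rigid: by `IsSparse.exists_pair`, every seagull has a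
vertex in the set `T` of vertices of `C` that swaps can uncover, and a second vertex that lies in
`T` or is complete or anticomplete to `T`. Either breaking up enough seagulls into two single
vertices each gives the required number of pieces, or the vertices anticomplete to `T` form a second
large clique and `HasModel.of_two_cliques` applies. -/

/-! ### Models made of single vertices and seagulls -/

/-- A seagull is the vertex set of an induced path on three vertices. -/
def IsSeagull (G : SimpleGraph V) (Q : Finset V) : Prop :=
  ∃ x z y, x ≠ y ∧ G.Adj x z ∧ G.Adj z y ∧ ¬G.Adj x y ∧ Q = {x, z, y}

/-- A piece is a single vertex or a seagull. -/
def IsPiece (G : SimpleGraph V) (B : Finset V) : Prop :=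
  (∃ x, B = {x}) ∨ IsSeagull G B

/-- The ends of a piece: the vertex of a singleton, the two ends of a seagull. -/
def IsEnd (G : SimpleGraph V) (B : Finset V) (x : V) : Prop :=
  x ∈ B ∧ (B = {x} ∨ ∃ y ∈ B, y ≠ x ∧ ¬G.Adj x y)

/-- Two pieces are linked if some end of the first is adjacent to some end of the second. -/
def Linked (G : SimpleGraph V) (B B' : Finset V) : Prop :=
  ∃ x y, IsEnd G B x ∧ IsEnd G B' y ∧ G.Adj x y

/-- Two families of `ℓ` and `r` pieces inside `S`, all pairwise disjoint, such that every piece of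
the first family is linked to every piece of the second. -/
def HasModel (G : SimpleGraph V) (S : Finset V) (ℓ r : ℕ) : Prop :=
  ∃ L R : Finset (Finset V), L.card = ℓ ∧ R.card = r ∧ Disjoint L R ∧
    (∀ B ∈ L ∪ R, B ⊆ S ∧ IsPiece G B) ∧
    ((L ∪ R : Finset (Finset V)) : Set (Finset V)).PairwiseDisjoint id ∧
    ∀ B ∈ L, ∀ B' ∈ R, Linked G B B'

/-- No three vertices are pairwise nonadjacent. -/
def NoIndepTriple (G : SimpleGraph V) : Prop :=
  ∀ x y z, x ≠ y → y ≠ z → x ≠ z → G.Adj x y ∨ G.Adj y z ∨ G.Adj x z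

lemma IsSeagull.card {Q : Finset V} (h : IsSeagull G Q) : Q.card = 3 := by
  obtain ⟨x, z, y, hxy, hxz, hzy, -, rfl⟩ := h
  rw [Finset.card_eq_three]
  exact ⟨x, z, y, hxz.ne, hxy, hzy.ne, rfl⟩

lemma IsPiece.nonempty {B : Finset V} (h : IsPiece G B) : B.Nonempty := by
  rcases h with ⟨x, rfl⟩ | h
  · simp
  · rw [← Finset.card_pos, h.card]; norm_num

lemma IsPiece.exists_isEnd {B : Finset V} (h : IsPiece G B) : ∃ x, IsEnd G B x := by
  rcases h with ⟨x, rfl⟩ | ⟨x, z, y, hxy, hxz, hzy, hn, rfl⟩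
  · exact ⟨x, by simp [IsEnd]⟩
  · exact ⟨x, by simp, Or.inr ⟨y, by simp, hxy.symm, hn⟩⟩

lemma isEnd_singleton (x : V) : IsEnd G {x} x := by simp [IsEnd]

lemma Linked.symm {B B' : Finset V} (h : Linked G B B') : Linked G B' B := by
  obtain ⟨x, y, hx, hy, h⟩ := h
  exact ⟨y, x, hy, hx, h.symm⟩

lemma HasModel.symm {S : Finset V} {ℓ r : ℕ} (h : HasModel G S ℓ r) : HasModel G S r ℓ := by
  obtain ⟨L, R, hL, hR, hd, hp, hpd, hl⟩ := h
  refine ⟨R, L, hR, hL, hd.symm, ?_, ?_, fun B hB B' hB' => (hl B' hB' B hB).symm⟩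
  · rwa [Finset.union_comm]
  · rwa [Finset.union_comm]

lemma HasModel.mono {S S' : Finset V} {ℓ r : ℕ} (h : HasModel G S ℓ r) (hS : S ⊆ S') :
    HasModel G S' ℓ r := by
  obtain ⟨L, R, hL, hR, hd, hp, hpd, hl⟩ := h
  exact ⟨L, R, hL, hR, hd, fun B hB => ⟨(hp B hB).1.trans hS, (hp B hB).2⟩, hpd, hl⟩

/-- Within a piece, two adjacent vertices are never both ends, nor both non-ends. -/
lemma IsPiece.isEnd_iff_not {B : Finset V} (h : IsPiece G B) {x y : V} (hx : x ∈ B) (hy : y ∈ B)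
    (hxy : G.Adj x y) : IsEnd G B x ↔ ¬IsEnd G B y := by
  rcases h with ⟨u, rfl⟩ | ⟨u, z, v, huv, huz, hzv, hn, rfl⟩
  · simp only [Finset.mem_singleton] at hx hy
    subst hx; subst hy
    exact (G.irrefl hxy).elim
  · have hcard : ∀ a : V, ({u, z, v} : Finset V) ≠ {a} := by
      intro a h
      have h1 : u ∈ ({a} : Finset V) := by rw [← h]; simp
      have h2 : v ∈ ({a} : Finset V) := by rw [← h]; simp
      simp only [Finset.mem_singleton] at h1 h2
      exact huv (h1.trans h2.symm)
    have hu : IsEnd G {u, z, v} u := ⟨by simp, Or.inr ⟨v, by simp, huv.symm, hn⟩⟩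
    have hv : IsEnd G {u, z, v} v :=
      ⟨by simp, Or.inr ⟨u, by simp, huv, fun h => hn h.symm⟩⟩
    have hz : ¬IsEnd G {u, z, v} z := by
      rintro ⟨-, h | ⟨a, ha, hne, hna⟩⟩
      · exact hcard _ h
      · simp only [Finset.mem_insert, Finset.mem_singleton] at ha
        rcases ha with rfl | rfl | rfl
        · exact hna huz.symm
        · exact hne rfl
        · exact hna hzv
    simp only [Finset.mem_insert, Finset.mem_singleton] at hx hy
    rcases hx with rfl | rfl | rfl <;> rcases hy with rfl | rfl | rfl <;>
      first
        | exact (G.irrefl hxy).elim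
        | exact (hn hxy).elim
        | exact (hn hxy.symm).elim
        | simp [hu, hv, hz]

lemma IsPiece.isTree_induce {B : Finset V} (h : IsPiece G B) :
    ((⊤ : G.Subgraph).induce (B : Set V)).coe.IsTree := by
  rcases h with ⟨u, rfl⟩ | ⟨u, z, v, huv, huz, hzv, hn, rfl⟩
  · have : Subsingleton ((⊤ : G.Subgraph).induce (({u} : Finset V) : Set V)).verts :=
      ⟨fun a b => Subtype.ext (by
        have ha := a.2
        have hb := b.2
        simp only [Subgraph.induce_verts, Finset.coe_singleton, Set.mem_singleton_iff] at ha hb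
        rw [ha, hb])⟩
    have : Nonempty ((⊤ : G.Subgraph).induce (({u} : Finset V) : Set V)).verts :=
      ⟨⟨u, by simp⟩⟩
    exact IsTree.of_subsingleton
  · have : ((⊤ : G.Subgraph).induce (({u, z, v} : Finset V) : Set V)).coe =
        starGraph ⟨z, by simp⟩ := by
      ext ⟨a, ha⟩ ⟨b, hb⟩
      simp only [Subgraph.induce_verts, Finset.coe_insert, Finset.coe_singleton,
        Set.mem_insert_iff, Set.mem_singleton_iff] at ha hb
      have h1 := huz.ne
      have h2 := hzv.ne
      have hn' : ¬G.Adj v u := fun h => hn h.symm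
      rcases ha with rfl | rfl | rfl <;> rcases hb with rfl | rfl | rfl <;>
        simp [starGraph_adj, *, huz.symm, hzv.symm, Ne.symm]
    rw [this]
    exact isTree_starGraph _

/-- Colour 0 goes to the ends of pieces and colour 1 to everything else. Edges inside a seagull join
its middle to an end, linking edges are restricted to those between ends, and the vertex of a
singleton counts as an end. -/
lemma HasModel.exists_isSpecialOdd [Fintype V] {ℓ r : ℕ} (h : HasModel G Finset.univ ℓ r) :
    ∃ M : Model (completeBipartiteGraph (Fin ℓ) (Fin r)) G, M.IsSpecialOdd := by
  classical
  obtain ⟨L, R, hL, hR, hd, hp, hpd, hl⟩ := h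
  let f : Fin ℓ ⊕ Fin r → Finset V :=
    Sum.elim (fun i => (L.equivFinOfCardEq hL).symm i) (fun i => (R.equivFinOfCardEq hR).symm i)
  have hf : ∀ w, f w ∈ L ∪ R := by
    rintro (i | i)
    · exact Finset.mem_union_left _ ((L.equivFinOfCardEq hL).symm i).2
    · exact Finset.mem_union_right _ ((R.equivFinOfCardEq hR).symm i).2
  have hinj : Function.Injective f := by
    rintro (i | i) (j | j) hij
    · simpa [f, Subtype.ext_iff] using hij
    · exact (Finset.disjoint_left.1 hd ((L.equivFinOfCardEq hL).symm i).2
        (by have : f (Sum.inl i) ∈ R := by rw [hij]; exact ((R.equivFinOfCardEq hR).symm j).2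
            exact this)).elim
    · exact (Finset.disjoint_left.1 hd ((L.equivFinOfCardEq hL).symm j).2
        (by have : f (Sum.inl j) ∈ R := by rw [← hij]; exact ((R.equivFinOfCardEq hR).symm i).2
            exact this)).elim
    · simpa [f, Subtype.ext_iff] using hij
  have hdis : ∀ u v, u ≠ v → Disjoint (f u) (f v) := fun u v huv =>
    hpd (hf u) (hf v) (fun h => huv (hinj h))
  have huniq : ∀ u v x, x ∈ f u → x ∈ f v → u = v := by
    intro u v x hu hv
    by_contra hne
    exact Finset.disjoint_left.1 (hdis u v hne) hu hv
  have hlink : ∀ u v, (completeBipartiteGraph (Fin ℓ) (Fin r)).Adj u v →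
      Linked G (f u) (f v) := by
    rintro (i | i) (j | j) hij
    · simp at hij
    · exact hl _ ((L.equivFinOfCardEq hL).symm i).2 _ ((R.equivFinOfCardEq hR).symm j).2
    · exact (hl _ ((L.equivFinOfCardEq hL).symm j).2 _ ((R.equivFinOfCardEq hR).symm i).2).symm
    · simp at hij
  let lk : SimpleGraph V :=
    { Adj := fun x y => G.Adj x y ∧ ∃ u v, (completeBipartiteGraph (Fin ℓ) (Fin r)).Adj u v ∧
        IsEnd G (f u) x ∧ IsEnd G (f v) y
      symm := ⟨fun x y ⟨h, u, v, huv, hx, hy⟩ => ⟨h.symm, v, u, huv.symm, hy, hx⟩⟩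
      loopless := ⟨fun x h => G.irrefl h.1⟩ }
  let M : Model (completeBipartiteGraph (Fin ℓ) (Fin r)) G :=
    { branch := fun w => (⊤ : G.Subgraph).induce (f w : Set V)
      isTree := fun w => (hp _ (hf w)).2.isTree_induce
      disjoint := fun u v huv => by
        simpa [Subgraph.induce_verts] using hdis u v huv
      link := lk
      link_le := fun x y h => h.1
      link_between := fun x y ⟨h, u, v, huv, hx, hy⟩ => ⟨u, v, huv, hx.1, hy.1⟩
      exists_link := fun u v huv => by
        obtain ⟨x, y, hx, hy, hxy⟩ := hlink u v huv
        exact ⟨x, hx.1, y, hy.1, hxy, u, v, huv, hx, hy⟩ }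
  refine ⟨M, fun x => if ∃ w, IsEnd G (f w) x then 0 else 1, ⟨?_, ?_⟩, 0, ?_⟩
  · intro w x y hxy
    obtain ⟨hx, hy, hadj⟩ := hxy
    have hx' : x ∈ f w := hx
    have hy' : y ∈ f w := hy
    have key : ∀ z ∈ f w, (∃ u, IsEnd G (f u) z) ↔ IsEnd G (f w) z := fun z hz =>
      ⟨fun ⟨u, hu⟩ => by rwa [huniq w u z hz hu.1], fun h => ⟨w, h⟩⟩
    have := (hp _ (hf w)).2.isEnd_iff_not hx' hy' hadj
    simp only [key x hx', key y hy', this]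
    by_cases h : IsEnd G (f w) y <;> simp [h]
  · rintro x y ⟨-, u, v, -, hx, hy⟩
    have h1 : ∃ w, IsEnd G (f w) x := ⟨u, hx⟩
    have h2 : ∃ w, IsEnd G (f w) y := ⟨v, hy⟩
    simp only [h1, h2]
  · intro w x hx
    have hx' : f w = {x} := by
      have : (f w : Set V) = {x} := hx
      exact_mod_cast this
    have h1 : ∃ w, IsEnd G (f w) x := ⟨w, by rw [hx']; exact isEnd_singleton x⟩
    simp only [h1, if_true]

/-! ### Assembling models from joins, cliques and seagulls -/

/-- If everything in `X` is adjacent to everything in `Y`, models in `X` and `Y` combine. -/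
lemma HasModel.join {X Y : Finset V} (hXY : ∀ x ∈ X, ∀ y ∈ Y, G.Adj x y) {a b c d : ℕ}
    (h₁ : HasModel G X a b) (h₂ : HasModel G Y c d) : HasModel G (X ∪ Y) (a + c) (b + d) := by
  obtain ⟨L, R, hL, hR, hd, hp, hpd, hl⟩ := h₁
  obtain ⟨L', R', hL', hR', hd', hp', hpd', hl'⟩ := h₂
  have hdis : ∀ B ∈ L ∪ R, ∀ B' ∈ L' ∪ R', Disjoint B B' := fun B hB B' hB' =>
    Finset.disjoint_left.2 fun x hx hx' =>
      G.irrefl (hXY x ((hp B hB).1 hx) x ((hp' B' hB').1 hx'))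
  have hne : ∀ B ∈ L ∪ R, ∀ B' ∈ L' ∪ R', B ≠ B' := by
    rintro B hB _ hB' rfl
    obtain ⟨x, hx⟩ := (hp B hB).2.nonempty
    exact Finset.disjoint_left.1 (hdis B hB B hB') hx hx
  have hlk : ∀ B ∈ L ∪ R, ∀ B' ∈ L' ∪ R', Linked G B B' := by
    intro B hB B' hB'
    obtain ⟨x, hx⟩ := (hp B hB).2.exists_isEnd
    obtain ⟨y, hy⟩ := (hp' B' hB').2.exists_isEnd
    exact ⟨x, y, hx, hy, hXY x ((hp B hB).1 hx.1) y ((hp' B' hB').1 hy.1)⟩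
  have hdd : ∀ {A A' : Finset (Finset V)}, A ⊆ L ∪ R → A' ⊆ L' ∪ R' → Disjoint A A' :=
    fun h h' => Finset.disjoint_left.2 fun B hB hB' => hne B (h hB) B (h' hB') rfl
  have e : (L ∪ L') ∪ (R ∪ R') = (L ∪ R) ∪ (L' ∪ R') := by
    ext; simp only [Finset.mem_union]; tauto
  refine ⟨L ∪ L', R ∪ R', ?_, ?_, ?_, ?_, ?_, ?_⟩
  · rw [Finset.card_union_of_disjoint (hdd Finset.subset_union_left Finset.subset_union_left),
      hL, hL']
  · rw [Finset.card_union_of_disjoint (hdd Finset.subset_union_right Finset.subset_union_right),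
      hR, hR']
  · rw [Finset.disjoint_union_left, Finset.disjoint_union_right, Finset.disjoint_union_right]
    exact ⟨⟨hd, hdd Finset.subset_union_left Finset.subset_union_right⟩,
      (hdd Finset.subset_union_right Finset.subset_union_left).symm, hd'⟩
  · rw [e]
    intro B hB
    rcases Finset.mem_union.1 hB with hB | hB
    · exact ⟨(hp B hB).1.trans Finset.subset_union_left, (hp B hB).2⟩
    · exact ⟨(hp' B hB).1.trans Finset.subset_union_right, (hp' B hB).2⟩
  · rw [e]
    intro B hB B' hB' hBB'
    rcases Finset.mem_union.1 (Finset.mem_coe.1 hB) with hB | hB <;>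
      rcases Finset.mem_union.1 (Finset.mem_coe.1 hB') with hB' | hB'
    · exact hpd hB hB' hBB'
    · exact hdis B hB B' hB'
    · exact (hdis B' hB' B hB).symm
    · exact hpd' hB hB' hBB'
  · intro B hB B' hB'
    rcases Finset.mem_union.1 hB with hB | hB <;> rcases Finset.mem_union.1 hB' with hB' | hB'
    · exact hl B hB B' hB'
    · exact hlk B (Finset.mem_union_left _ hB) B' (Finset.mem_union_right _ hB')
    · exact (hlk B' (Finset.mem_union_right _ hB') B (Finset.mem_union_left _ hB)).symm
    · exact hl' B hB B' hB'

/-- The two ends of a seagull dominate all other vertices. -/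
lemma IsSeagull.linked (hG : NoIndepTriple G) {Q B : Finset V} (hQ : IsSeagull G Q)
    (hB : IsPiece G B) (hd : Disjoint Q B) : Linked G Q B := by
  obtain ⟨b, hb⟩ := hB.exists_isEnd
  obtain ⟨x, z, y, hxy, hxz, hzy, hn, rfl⟩ := hQ
  have hbQ : b ∉ ({x, z, y} : Finset V) := fun h => Finset.disjoint_left.1 hd h hb.1
  simp only [Finset.mem_insert, Finset.mem_singleton, not_or] at hbQ
  rcases hG x y b hxy (Ne.symm hbQ.2.2) (Ne.symm hbQ.1) with h | h | h
  · exact (hn h).elim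
  · exact ⟨y, b, ⟨by simp, Or.inr ⟨x, by simp, hxy, fun h => hn h.symm⟩⟩, hb, h⟩
  · exact ⟨x, b, ⟨by simp, Or.inr ⟨y, by simp, hxy.symm, hn⟩⟩, hb, h⟩

/-- A family of pairwise disjoint seagulls inside `S`. -/
def IsPacking (G : SimpleGraph V) (S : Finset V) (P : Finset (Finset V)) : Prop :=
  (∀ Q ∈ P, IsSeagull G Q ∧ Q ⊆ S) ∧ (P : Set (Finset V)).PairwiseDisjoint id

lemma isPacking_empty (S : Finset V) : IsPacking G S ∅ := by simp [IsPacking]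

lemma IsPacking.subset {S : Finset V} {P P' : Finset (Finset V)} (h : IsPacking G S P)
    (hP : P' ⊆ P) : IsPacking G S P' :=
  ⟨fun Q hQ => h.1 Q (hP hQ), h.2.subset (by exact_mod_cast hP)⟩

lemma singleton_image_card (K : Finset V) :
    (K.image (fun x => ({x} : Finset V))).card = K.card :=
  Finset.card_image_of_injective _ Finset.singleton_injective

/-- A clique `K`, a set `Z` complete to `K`, and a packing of seagulls avoiding both, yield a
model: the vertices of `K` and the seagulls can be put on either side, those of `Z` on the right. -/
lemma HasModel.of_clique (hG : NoIndepTriple G) {S K Z : Finset V} {P : Finset (Finset V)}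
    {ℓ r : ℕ} (hP : IsPacking G S P) (hKS : K ⊆ S) (hZS : Z ⊆ S)
    (hK : ∀ x ∈ K, ∀ y ∈ K, x ≠ y → G.Adj x y) (hKZ : ∀ x ∈ K, ∀ y ∈ Z, G.Adj x y)
    (hPK : ∀ Q ∈ P, Disjoint Q K) (hPZ : ∀ Q ∈ P, Disjoint Q Z)
    (h₁ : ℓ ≤ K.card + P.card) (h₂ : ℓ + r ≤ K.card + P.card + Z.card) : HasModel G S ℓ r := by
  -- Vertices of `Z` need not be adjacent to one another, so they may only go to the right. As many
  -- of them as fit are used there, which leaves enough of `K` and `P` for the rest.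
  obtain ⟨Z', hZ', hZc⟩ : ∃ Z' ⊆ Z, Z'.card = min r Z.card :=
    Finset.exists_subset_card_eq (min_le_right _ _)
  set KK := K.image (fun x => ({x} : Finset V)) with hKK
  set ZZ := Z'.image (fun x => ({x} : Finset V)) with hZZ
  have hKP : Disjoint KK P := by
    refine Finset.disjoint_left.2 fun B hB hB' => ?_
    obtain ⟨x, -, rfl⟩ := Finset.mem_image.1 hB
    simpa using (hP.1 _ hB').1.card
  have hZP : Disjoint ZZ P := by
    refine Finset.disjoint_left.2 fun B hB hB' => ?_
    obtain ⟨x, -, rfl⟩ := Finset.mem_image.1 hB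
    simpa using (hP.1 _ hB').1.card
  have hKZd : Disjoint KK ZZ := by
    refine Finset.disjoint_left.2 fun B hB hB' => ?_
    obtain ⟨x, hx, rfl⟩ := Finset.mem_image.1 hB
    obtain ⟨y, hy, hxy⟩ := Finset.mem_image.1 hB'
    rw [Finset.singleton_inj] at hxy
    subst hxy
    exact G.irrefl (hKZ _ hx _ (hZ' hy))
  have hΦ : (KK ∪ P).card = K.card + P.card := by
    rw [Finset.card_union_of_disjoint hKP, hKK, singleton_image_card]
  obtain ⟨L, hL, hLc⟩ : ∃ L ⊆ KK ∪ P, L.card = ℓ :=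
    Finset.exists_subset_card_eq (by omega)
  obtain ⟨R, hR, hRc⟩ : ∃ R ⊆ (KK ∪ P) \ L, R.card = r - Z'.card :=
    Finset.exists_subset_card_eq (by rw [Finset.card_sdiff_of_subset hL]; omega)
  have hR' : R ⊆ KK ∪ P := hR.trans Finset.sdiff_subset
  have hLR : Disjoint L R :=
    Finset.disjoint_left.2 fun B hB hB' => (Finset.mem_sdiff.1 (hR hB')).2 hB
  have hΦZ : Disjoint (KK ∪ P) ZZ := Finset.disjoint_union_left.2 ⟨hKZd, hZP.symm⟩
  have hall : L ∪ (R ∪ ZZ) ⊆ KK ∪ P ∪ ZZ := by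
    refine Finset.union_subset (hL.trans Finset.subset_union_left)
      (Finset.union_subset_union_left hR')
  have hpiece : ∀ B ∈ KK ∪ P ∪ ZZ, B ⊆ S ∧ IsPiece G B := by
    intro B hB
    simp only [Finset.mem_union, hKK, hZZ, Finset.mem_image] at hB
    rcases hB with (⟨x, hx, rfl⟩ | hB) | ⟨x, hx, rfl⟩
    · exact ⟨Finset.singleton_subset_iff.2 (hKS hx), Or.inl ⟨x, rfl⟩⟩
    · exact ⟨(hP.1 B hB).2, Or.inr (hP.1 B hB).1⟩
    · exact ⟨Finset.singleton_subset_iff.2 (hZS (hZ' hx)), Or.inl ⟨x, rfl⟩⟩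
  have hsing : ∀ B ∈ KK ∪ P ∪ ZZ, B ∉ P → ∃ x ∈ K ∪ Z, B = {x} := by
    intro B hB hBP
    simp only [Finset.mem_union, hKK, hZZ, Finset.mem_image] at hB
    rcases hB with (⟨x, hx, rfl⟩ | hB) | ⟨x, hx, rfl⟩
    · exact ⟨x, Finset.mem_union_left _ hx, rfl⟩
    · exact (hBP hB).elim
    · exact ⟨x, Finset.mem_union_right _ (hZ' hx), rfl⟩
  have hPs : ∀ Q ∈ P, ∀ x ∈ K ∪ Z, Disjoint Q {x} := by
    intro Q hQ x hx
    rw [Finset.disjoint_singleton_right]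
    intro hxQ
    rcases Finset.mem_union.1 hx with hx | hx
    · exact Finset.disjoint_left.1 (hPK Q hQ) hxQ hx
    · exact Finset.disjoint_left.1 (hPZ Q hQ) hxQ hx
  have hpd : ∀ B ∈ KK ∪ P ∪ ZZ, ∀ B' ∈ KK ∪ P ∪ ZZ, B ≠ B' → Disjoint B B' := by
    intro B hB B' hB' hne
    by_cases h : B ∈ P <;> by_cases h' : B' ∈ P
    · exact hP.2 h h' hne
    · obtain ⟨x, hx, rfl⟩ := hsing B' hB' h'
      exact hPs B h x hx
    · obtain ⟨x, hx, rfl⟩ := hsing B hB h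
      exact (hPs B' h' x hx).symm
    · obtain ⟨x, hx, rfl⟩ := hsing B hB h
      obtain ⟨y, hy, rfl⟩ := hsing B' hB' h'
      simpa using hne
  have hLRZ : Disjoint L (R ∪ ZZ) :=
    Finset.disjoint_union_right.2 ⟨hLR, Finset.disjoint_of_subset_left hL hΦZ⟩
  refine ⟨L, R ∪ ZZ, hLc, ?_, hLRZ, fun B hB => hpiece B (hall hB),
    fun B hB B' hB' hne => hpd B (hall hB) B' (hall hB') hne, ?_⟩
  · rw [Finset.card_union_of_disjoint (Finset.disjoint_of_subset_left hR' hΦZ), hZZ,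
      singleton_image_card]
    omega
  · intro B hB B' hB'
    have hBa := hall (Finset.mem_union_left _ hB)
    have hBa' := hall (Finset.mem_union_right _ hB')
    have hne : B ≠ B' := by
      rintro rfl
      exact Finset.disjoint_left.1 hLRZ hB hB'
    have hd := hpd B hBa B' hBa' hne
    by_cases h : B ∈ P
    · exact (hP.1 B h).1.linked hG (hpiece B' hBa').2 hd
    by_cases h' : B' ∈ P
    · exact ((hP.1 B' h').1.linked hG (hpiece B hBa).2 hd.symm).symm
    have hBK : B ∈ KK := (Finset.mem_union.1 (hL hB)).resolve_right h
    obtain ⟨x, hx, rfl⟩ := Finset.mem_image.1 hBK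
    refine ⟨x, ?_⟩
    rcases Finset.mem_union.1 hB' with hB' | hB'
    · have hBK' : B' ∈ KK := (Finset.mem_union.1 (hR' hB')).resolve_right h'
      obtain ⟨y, hy, rfl⟩ := Finset.mem_image.1 hBK'
      exact ⟨y, isEnd_singleton x, isEnd_singleton y, hK x hx y hy (by simpa using hne)⟩
    · obtain ⟨y, hy, rfl⟩ := Finset.mem_image.1 hB'
      exact ⟨y, isEnd_singleton x, isEnd_singleton y, hKZ x hx y (hZ' hy)⟩

/-- Two large cliques without edges between them yield a model. -/
lemma HasModel.of_two_cliques (hG : NoIndepTriple G) {S X Y : Finset V} {ℓ r : ℕ}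
    (hS : 2 * (ℓ + r) ≤ S.card + 1) (hXS : X ⊆ S) (hYS : Y ⊆ S)
    (hX : ∀ x ∈ X, ∀ y ∈ X, x ≠ y → G.Adj x y) (hY : ∀ x ∈ Y, ∀ y ∈ Y, x ≠ y → G.Adj x y)
    (hXY : ∀ x ∈ X, ∀ y ∈ Y, x ≠ y ∧ ¬G.Adj x y) (hXc : ℓ ≤ X.card) (hYc : ℓ ≤ Y.card) :
    HasModel G S ℓ r := by
  classical
  have hd : Disjoint X Y := Finset.disjoint_left.2 fun x hx hy => (hXY x hx x hy).1 rfl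
  set U := S \ (X ∪ Y) with hU
  set A := U.filter (fun v => ∀ x ∈ X, G.Adj x v) with hA
  set B := U.filter (fun v => ∀ y ∈ Y, G.Adj y v) with hB
  -- A vertex with a nonneighbour in `X` and another in `Y` would complete an independent triple.
  have hUAB : U ⊆ A ∪ B := by
    intro v hv
    by_contra hcon
    simp only [Finset.mem_union, hA, hB, Finset.mem_filter, hv, true_and, not_or, not_forall] at hcon
    obtain ⟨⟨x, hx, hxv⟩, y, hy, hyv⟩ := hcon
    have hv' : v ∉ X ∪ Y := (Finset.mem_sdiff.1 hv).2
    rw [Finset.mem_union, not_or] at hv'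
    rcases hG x y v (hXY x hx y hy).1 (by rintro rfl; exact hv'.2 hy)
      (by rintro rfl; exact hv'.1 hx) with h | h | h
    · exact (hXY x hx y hy).2 h
    · exact hyv h
    · exact hxv h
  have hcard : U.card + (X.card + Y.card) = S.card := by
    rw [← Finset.card_union_of_disjoint hd, hU,
      Finset.card_sdiff_add_card_eq_card (Finset.union_subset hXS hYS)]
  have hUc : U.card ≤ A.card + B.card :=
    (Finset.card_le_card hUAB).trans (Finset.card_union_le _ _)
  have hUS : U ⊆ S := Finset.sdiff_subset
  -- The sums `|X| + |A|` and `|Y| + |B|` add up to at least `|S| ≥ 2 (ℓ + r) - 1`, so one of them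
  -- is at least `ℓ + r`.
  rcases le_or_gt (ℓ + r) (X.card + A.card) with h | h
  · refine HasModel.of_clique hG (isPacking_empty S) hXS ((Finset.filter_subset _ _).trans hUS) hX
      (Z := A) (fun x hx y hy => (Finset.mem_filter.1 hy).2 x hx) (by simp) (by simp)
      (by simpa using hXc) (by simpa using h)
  · refine HasModel.of_clique hG (isPacking_empty S) hYS ((Finset.filter_subset _ _).trans hUS) hY
      (Z := B) (fun x hx y hy => (Finset.mem_filter.1 hy).2 x hx) (by simp) (by simp)
      (by simpa using hYc) (by simp only [Finset.card_empty]; omega)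

/-! ### Exchanging vertices of a seagull -/

/-- If `c` sees the whole path, it can replace the middle. If it sees the middle but misses an end,
it replaces the other end. If it misses the middle, it sees one of the ends, which becomes the
middle between `c` and the old middle. -/
lemma IsSeagull.exists_mem_of_notMem (hG : NoIndepTriple G) {Q : Finset V} (hQ : IsSeagull G Q)
    {c : V} (hc : c ∉ Q) : ∃ Q' ⊆ insert c Q, IsSeagull G Q' ∧ c ∈ Q' := by
  obtain ⟨x, z, y, hxy, hxz, hzy, hn, rfl⟩ := hQ
  simp only [Finset.mem_insert, Finset.mem_singleton, not_or] at hc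
  obtain ⟨hcx, hcz, hcy⟩ := hc
  have key : ∀ a m b, a ≠ b → G.Adj a m → G.Adj m b → ¬G.Adj a b →
      a ∈ ({c, x, z, y} : Finset V) → m ∈ ({c, x, z, y} : Finset V) →
      b ∈ ({c, x, z, y} : Finset V) → c ∈ ({a, m, b} : Finset V) →
      ∃ Q' ⊆ insert c ({x, z, y} : Finset V), IsSeagull G Q' ∧ c ∈ Q' := by
    intro a m b hab ham hmb hnab ha hm hb hcm
    refine ⟨{a, m, b}, ?_, ⟨a, m, b, hab, ham, hmb, hnab, rfl⟩, hcm⟩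
    intro t ht
    simp only [Finset.mem_insert, Finset.mem_singleton] at ht
    rcases ht with rfl | rfl | rfl <;> assumption
  by_cases h : G.Adj c z
  · by_cases hx : G.Adj c x
    · by_cases hy : G.Adj c y
      · exact key x c y hxy hx.symm hy hn (by simp) (by simp) (by simp) (by simp)
      · exact key c z y hcy h hzy hy (by simp) (by simp) (by simp) (by simp)
    · exact key c z x hcx h hxz.symm hx (by simp) (by simp) (by simp) (by simp)
  · rcases hG x y c hxy (Ne.symm hcy) (Ne.symm hcx) with h' | h' | h'
    · exact (hn h').elim
    · exact key c y z hcz h'.symm hzy.symm h (by simp) (by simp) (by simp) (by simp)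
    · exact key c x z hcz h'.symm hxz h (by simp) (by simp) (by simp) (by simp)

lemma isSeagull_of_mixed {c c' v : V} (h : G.Adj c c') (hv : G.Adj v c) (hv' : ¬G.Adj v c')
    (hne : v ≠ c') : IsSeagull G {c', c, v} :=
  ⟨c', c, v, hne.symm, h.symm, hv.symm, fun h => hv' h.symm, rfl⟩

/-- A seagull spans exactly two edges, so besides `ab` there is exactly one more. -/
lemma IsSeagull.adj_iff_not_adj {Q : Finset V} (hQ : IsSeagull G Q) {a b v : V} (ha : a ∈ Q)
    (hb : b ∈ Q) (hv : v ∈ Q) (hva : v ≠ a) (hvb : v ≠ b) (hab : G.Adj a b) :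
    G.Adj v a ↔ ¬G.Adj v b := by
  obtain ⟨x, z, y, hxy, hxz, hzy, hn, rfl⟩ := hQ
  simp only [Finset.mem_insert, Finset.mem_singleton] at ha hb hv
  have := hxz.symm
  have := hzy.symm
  have hn' : ¬G.Adj y x := fun h => hn h.symm
  have := hab.ne
  rcases ha with rfl | rfl | rfl <;> rcases hb with rfl | rfl | rfl <;>
    rcases hv with rfl | rfl | rfl <;> simp_all

lemma IsSeagull.swap {Q : Finset V} (hQ : IsSeagull G Q) {c d : V} (hd : d ∈ Q) (hc : c ∉ Q)
    (h : ∀ p ∈ Q, p ≠ d → (G.Adj p c ↔ G.Adj p d)) : IsSeagull G (insert c (Q.erase d)) := by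
  obtain ⟨x, z, y, hxy, hxz, hzy, hn, rfl⟩ := hQ
  simp only [Finset.mem_insert, Finset.mem_singleton, not_or] at hc hd
  obtain ⟨hcx, hcz, hcy⟩ := hc
  have h1 := hxz.ne
  have h2 := hzy.ne
  have hx := h x (by simp)
  have hy := h y (by simp)
  have hz := h z (by simp)
  rcases hd with rfl | rfl | rfl
  · refine ⟨c, z, y, hcy, ((hz h1.symm).2 hxz.symm).symm, hzy,
      fun h => hn ((hy hxy.symm).1 h.symm).symm, ?_⟩
    ext t; simp only [Finset.mem_insert, Finset.mem_erase, Finset.mem_singleton]; grind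
  · refine ⟨x, c, y, hxy, (hx h1).2 hxz, ((hy h2.symm).2 hzy.symm).symm, hn, ?_⟩
    ext t; simp only [Finset.mem_insert, Finset.mem_erase, Finset.mem_singleton]; grind
  · refine ⟨x, z, c, Ne.symm hcx, hxz, (hz h2).2 hzy, fun h => hn ((hx hxy).1 h), ?_⟩
    ext t; simp only [Finset.mem_insert, Finset.mem_erase, Finset.mem_singleton]; grind

/-! ### Packings that cover as much of a clique as possible -/

/-- The vertices covered by a family of sets. -/
def covered (P : Finset (Finset V)) : Finset V := P.biUnion id

lemma mem_covered {P : Finset (Finset V)} {v : V} : v ∈ covered P ↔ ∃ Q ∈ P, v ∈ Q := by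
  simp [covered]

/-- The number of vertices of `C` in members of `P`. -/
def weight (C : Finset V) (P : Finset (Finset V)) : ℕ := ∑ Q ∈ P, (Q ∩ C).card

lemma card_covered_inter {P : Finset (Finset V)}
    (hP : (P : Set (Finset V)).PairwiseDisjoint id) (C : Finset V) :
    (covered P ∩ C).card = weight C P := by
  rw [covered, Finset.biUnion_inter, Finset.card_biUnion]
  · rfl
  · intro Q hQ Q' hQ' hne
    exact Finset.disjoint_of_subset_left Finset.inter_subset_left
      (Finset.disjoint_of_subset_right Finset.inter_subset_left (hP hQ hQ' hne))

lemma card_sdiff_covered_add_weight {P : Finset (Finset V)}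
    (hP : (P : Set (Finset V)).PairwiseDisjoint id) (C : Finset V) :
    (C \ covered P).card + weight C P = C.card := by
  rw [← card_covered_inter hP, Finset.inter_comm, Finset.card_sdiff_add_card_inter]

lemma IsPacking.card_covered {S : Finset V} {P : Finset (Finset V)} (hP : IsPacking G S P) :
    (covered P).card = 3 * P.card := by
  rw [covered, Finset.card_biUnion hP.2]
  exact (Finset.sum_congr rfl fun Q hQ => (hP.1 Q hQ).1.card).trans (by simp [mul_comm])

lemma IsPacking.covered_subset {S : Finset V} {P : Finset (Finset V)} (hP : IsPacking G S P) :
    covered P ⊆ S := by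
  intro v hv
  obtain ⟨Q, hQ, hv⟩ := mem_covered.1 hv
  exact (hP.1 Q hQ).2 hv

/-- Replacing one member of a packing by another seagull. -/
lemma IsPacking.replace {S C : Finset V} {P : Finset (Finset V)} (hP : IsPacking G S P)
    {Q Q' : Finset V} (hQ : Q ∈ P) (hQ' : IsSeagull G Q') (hS : Q' ⊆ S)
    (hd : ∀ B ∈ P, B ≠ Q → Disjoint B Q') :
    IsPacking G S (insert Q' (P.erase Q)) ∧ (insert Q' (P.erase Q)).card = P.card ∧
      weight C (insert Q' (P.erase Q)) + (Q ∩ C).card = weight C P + (Q' ∩ C).card := by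
  have hnot : Q' ∉ P.erase Q := by
    intro h
    have := hd Q' (Finset.mem_of_mem_erase h) (Finset.ne_of_mem_erase h)
    rw [disjoint_self, Finset.bot_eq_empty] at this
    have hc := hQ'.card
    simp [this] at hc
  refine ⟨⟨?_, ?_⟩, ?_, ?_⟩
  · intro B hB
    rcases Finset.mem_insert.1 hB with rfl | hB
    · exact ⟨hQ', hS⟩
    · exact hP.1 B (Finset.mem_of_mem_erase hB)
  · rw [Finset.coe_insert]
    refine Set.PairwiseDisjoint.insert (hP.2.subset (by simp)) ?_
    intro B hB _
    have hB' : B ∈ P.erase Q := hB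
    exact (hd B (Finset.mem_of_mem_erase hB') (Finset.ne_of_mem_erase hB')).symm
  · rw [Finset.card_insert_of_notMem hnot, Finset.card_erase_add_one hQ]
  · rw [weight, Finset.sum_insert hnot, weight, ← Finset.add_sum_erase P _ hQ]
    ring

/-- A packing that covers as many vertices of `C` as possible among packings of its size. -/
def IsOptimal (G : SimpleGraph V) (S C : Finset V) (P : Finset (Finset V)) : Prop :=
  IsPacking G S P ∧ ∀ P', IsPacking G S P' → P'.card = P.card → weight C P' ≤ weight C P

lemma IsOptimal.card_inter_le {S C : Finset V} {P : Finset (Finset V)} (hP : IsOptimal G S C P)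
    {Q Q' : Finset V} (hQ : Q ∈ P) (hQ' : IsSeagull G Q') (hS : Q' ⊆ S)
    (hd : ∀ B ∈ P, B ≠ Q → Disjoint B Q') : (Q' ∩ C).card ≤ (Q ∩ C).card := by
  obtain ⟨h1, h2, h3⟩ := hP.1.replace (C := C) hQ hQ' hS hd
  have := hP.2 _ h1 h2
  omega

lemma IsOptimal.replace {S C : Finset V} {P : Finset (Finset V)} (hP : IsOptimal G S C P)
    {Q Q' : Finset V} (hQ : Q ∈ P) (hQ' : IsSeagull G Q') (hS : Q' ⊆ S)
    (hd : ∀ B ∈ P, B ≠ Q → Disjoint B Q') (hc : (Q ∩ C).card ≤ (Q' ∩ C).card) :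
    IsOptimal G S C (insert Q' (P.erase Q)) := by
  obtain ⟨h1, h2, h3⟩ := hP.1.replace (C := C) hQ hQ' hS hd
  refine ⟨h1, fun P' hP' hcard => ?_⟩
  have := hP.2 P' hP' (hcard.trans h2)
  omega

/-- A member avoiding `C` could be exchanged for a seagull through an uncovered vertex of `C`, which
would raise the weight. -/
lemma IsOptimal.inter_nonempty (hG : NoIndepTriple G) {S C : Finset V} {P : Finset (Finset V)}
    (hP : IsOptimal G S C P) (hCS : C ⊆ S) (hne : (C \ covered P).Nonempty) {Q : Finset V}
    (hQ : Q ∈ P) : (Q ∩ C).Nonempty := by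
  obtain ⟨c, hc⟩ := hne
  obtain ⟨hcC, hcP⟩ := Finset.mem_sdiff.1 hc
  have hcn : ∀ B ∈ P, c ∉ B := fun B hB h => hcP (mem_covered.2 ⟨B, hB, h⟩)
  obtain ⟨Q', hsub, hQ', hcQ'⟩ := (hP.1.1 Q hQ).1.exists_mem_of_notMem hG (hcn Q hQ)
  have := hP.card_inter_le hQ hQ'
    (hsub.trans (Finset.insert_subset (hCS hcC) (hP.1.1 Q hQ).2)) (fun B hB hne =>
      Finset.disjoint_of_subset_right hsub (Finset.disjoint_insert_right.2
        ⟨hcn B hB, hP.1.2 hB hQ hne⟩))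
  have hpos : 0 < (Q' ∩ C).card := Finset.card_pos.2 ⟨c, Finset.mem_inter.2 ⟨hcQ', hcC⟩⟩
  exact Finset.card_pos.1 (by omega)

/-- Let `Q` be a member of an optimal packing with at most one vertex in `C`. A vertex outside `C`
does not distinguish two vertices of `C` if none of the three is in another member. -/
lemma IsOptimal.not_mixed {S C : Finset V} {P : Finset (Finset V)} (hP : IsOptimal G S C P)
    (hC : ∀ x ∈ C, ∀ y ∈ C, x ≠ y → G.Adj x y) (hCS : C ⊆ S) {v c c' : V} (hvS : v ∈ S)
    (hvC : v ∉ C) (hc : c ∈ C) (hc' : c' ∈ C) {Q : Finset V} (hQ : Q ∈ P)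
    (hcard : (Q ∩ C).card ≤ 1) (hcQ : ∀ B ∈ P, B ≠ Q → c ∉ B) (hcQ' : ∀ B ∈ P, B ≠ Q → c' ∉ B)
    (hvQ : ∀ B ∈ P, B ≠ Q → v ∉ B) (hvc : G.Adj v c) : G.Adj v c' := by
  by_contra hvc'
  have hne : c ≠ c' := by rintro rfl; exact hvc' hvc
  -- This seagull has two vertices in `C`, so putting it in place of `Q` would contradict
  -- optimality.
  have hsg := isSeagull_of_mixed (hC c hc c' hc' hne) hvc hvc' (by rintro rfl; exact hvC hc')
  have h1 := hP.card_inter_le hQ hsg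
    (by
      intro t ht
      simp only [Finset.mem_insert, Finset.mem_singleton] at ht
      rcases ht with rfl | rfl | rfl
      exacts [hCS hc', hCS hc, hvS])
    (fun B hB hBQ => by
      simp only [Finset.disjoint_insert_right, Finset.disjoint_singleton_right]
      exact ⟨hcQ' B hB hBQ, hcQ B hB hBQ, hvQ B hB hBQ⟩)
  have h2 : ({c', c} : Finset V) ⊆ {c', c, v} ∩ C := by
    intro t ht
    simp only [Finset.mem_insert, Finset.mem_singleton, Finset.mem_inter] at ht ⊢
    rcases ht with rfl | rfl
    exacts [⟨Or.inl rfl, hc'⟩, ⟨Or.inr (Or.inl rfl), hc⟩]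
  have h3 := Finset.card_le_card h2
  rw [Finset.card_pair hne.symm] at h3
  omega

/-! ### Swaps and loose vertices -/

/-- `P'` arises from `P` by replacing the vertex `d ∈ C` of the seagull `Q ∈ P` by the uncovered
vertex `c ∈ C`. -/
def IsSwap (G : SimpleGraph V) (C : Finset V) (P P' : Finset (Finset V)) (Q : Finset V)
    (d c : V) : Prop :=
  Q ∈ P ∧ d ∈ Q ∧ d ∈ C ∧ c ∈ C \ covered P ∧ IsSeagull G (insert c (Q.erase d)) ∧
    P' = insert (insert c (Q.erase d)) (P.erase Q)

/-- `P'` can be reached from `P` by a sequence of swaps. -/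
def Reach (G : SimpleGraph V) (C : Finset V) : Finset (Finset V) → Finset (Finset V) → Prop :=
  Relation.ReflTransGen fun P P' => ∃ Q d c, IsSwap G C P P' Q d c

lemma IsSwap.covered_eq {S C : Finset V} {P P' : Finset (Finset V)} {Q : Finset V} {d c : V}
    (h : IsSwap G C P P' Q d c) (hP : IsPacking G S P) :
    covered P' = insert c ((covered P).erase d) := by
  obtain ⟨hQ, hdQ, hdC, hc, hsg, rfl⟩ := h
  ext v
  simp only [mem_covered, Finset.mem_insert, Finset.mem_erase]
  constructor
  · rintro ⟨B, rfl | ⟨hBQ, hB⟩, hv⟩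
    · rcases Finset.mem_insert.1 hv with rfl | hv
      · exact Or.inl rfl
      · exact Or.inr ⟨Finset.ne_of_mem_erase hv, Q, hQ, Finset.mem_of_mem_erase hv⟩
    · refine Or.inr ⟨?_, B, hB, hv⟩
      rintro rfl
      exact Finset.disjoint_left.1 (hP.2 hB hQ hBQ) hv hdQ
  · rintro (rfl | ⟨hvd, B, hB, hv⟩)
    · exact ⟨_, Or.inl rfl, Finset.mem_insert_self _ _⟩
    · by_cases hBQ : B = Q
      · subst hBQ
        exact ⟨_, Or.inl rfl, Finset.mem_insert_of_mem (Finset.mem_erase.2 ⟨hvd, hv⟩)⟩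
      · exact ⟨B, Or.inr ⟨hBQ, hB⟩, hv⟩

lemma IsSwap.isOptimal {S C : Finset V} {P P' : Finset (Finset V)} {Q : Finset V} {d c : V}
    (h : IsSwap G C P P' Q d c) (hCS : C ⊆ S) (hP : IsOptimal G S C P) :
    IsOptimal G S C P' ∧ P'.card = P.card := by
  obtain ⟨hQ, hdQ, hdC, hc, hsg, rfl⟩ := h
  obtain ⟨hcC, hcP⟩ := Finset.mem_sdiff.1 hc
  have hcn : ∀ B ∈ P, c ∉ B := fun B hB h => hcP (mem_covered.2 ⟨B, hB, h⟩)
  have hS : insert c (Q.erase d) ⊆ S :=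
    Finset.insert_subset (hCS hcC) ((Finset.erase_subset _ _).trans (hP.1.1 Q hQ).2)
  have hd : ∀ B ∈ P, B ≠ Q → Disjoint B (insert c (Q.erase d)) := fun B hB hBQ =>
    Finset.disjoint_insert_right.2 ⟨hcn B hB,
      Finset.disjoint_of_subset_right (Finset.erase_subset _ _) (hP.1.2 hB hQ hBQ)⟩
  refine ⟨hP.replace hQ hsg hS hd (le_of_eq ?_), (hP.1.replace (C := C) hQ hsg hS hd).2.1⟩
  rw [Finset.insert_inter_of_mem hcC, Finset.erase_inter, Finset.card_insert_of_notMem,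
    Finset.card_erase_add_one (Finset.mem_inter.2 ⟨hdQ, hdC⟩)]
  simp [hcn Q hQ]

/-- An optimal packing that misses at least two vertices of `C` and has a member with at most
one vertex in `C`. -/
structure IsSparse (G : SimpleGraph V) (S C : Finset V) (P : Finset (Finset V)) : Prop where
  isOptimal : IsOptimal G S C P
  two_le : 2 ≤ (C \ covered P).card
  weight_lt : weight C P < 2 * P.card

lemma IsSparse.exists_card_le_one {S C : Finset V} {P : Finset (Finset V)}
    (h : IsSparse G S C P) : ∃ Q ∈ P, (Q ∩ C).card ≤ 1 := by
  by_contra! hcon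
  have h1 : P.card * 2 ≤ weight C P := by
    rw [weight, ← smul_eq_mul]
    exact Finset.card_nsmul_le_sum _ _ _ fun Q hQ => hcon Q hQ
  have := h.weight_lt
  omega

/-- Both packings are optimal and of the same size, so their weights agree, and hence so do the
numbers of uncovered vertices of `C`. -/
lemma IsSwap.isSparse {S C : Finset V} {P P' : Finset (Finset V)} {Q : Finset V} {d c : V}
    (h : IsSwap G C P P' Q d c) (hCS : C ⊆ S) (hP : IsSparse G S C P) : IsSparse G S C P' := by
  obtain ⟨hopt, hcard⟩ := h.isOptimal hCS hP.isOptimal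
  have hw : weight C P' = weight C P :=
    le_antisymm (hP.isOptimal.2 _ hopt.1 hcard) (hopt.2 _ hP.isOptimal.1 hcard.symm)
  refine ⟨hopt, ?_, by rw [hw, hcard]; exact hP.weight_lt⟩
  have h1 := card_sdiff_covered_add_weight hopt.1.2 C
  have h2 := card_sdiff_covered_add_weight hP.isOptimal.1.2 C
  have := hP.two_le
  omega

lemma Reach.isSparse {S C : Finset V} {P P' : Finset (Finset V)} (h : Reach G C P P')
    (hCS : C ⊆ S) (hP : IsSparse G S C P) : IsSparse G S C P' := by
  induction h with
  | refl => exact hP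
  | tail _ hs ih =>
    obtain ⟨Q, d, c, hs⟩ := hs
    exact hs.isSparse hCS ih

lemma Reach.covered_sdiff {S C : Finset V} {P P' : Finset (Finset V)} (h : Reach G C P P')
    (hCS : C ⊆ S) (hP : IsSparse G S C P) : covered P' \ C = covered P \ C := by
  induction h with
  | refl => rfl
  | @tail P₁ P₂ h₁ hs ih =>
    obtain ⟨Q, d, c, hs⟩ := hs
    rw [← ih, hs.covered_eq (Reach.isSparse h₁ hCS hP).isOptimal.1,
      Finset.insert_sdiff_of_mem _ (Finset.mem_sdiff.1 hs.2.2.2.1).1]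
    ext v
    have := hs.2.2.1
    simp only [Finset.mem_sdiff, Finset.mem_erase]
    grind

open Classical in
/-- The vertices of `C` that can be uncovered by swaps. -/
noncomputable def loose (G : SimpleGraph V) (C : Finset V) (P : Finset (Finset V)) : Finset V :=
  C.filter fun c => ∃ P', Reach G C P P' ∧ c ∉ covered P'

lemma mem_loose {C : Finset V} {P : Finset (Finset V)} {c : V} :
    c ∈ loose G C P ↔ c ∈ C ∧ ∃ P', Reach G C P P' ∧ c ∉ covered P' := by
  simp [loose]

lemma sdiff_covered_subset_loose {C : Finset V} {P : Finset (Finset V)} :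
    C \ covered P ⊆ loose G C P := fun _ hc =>
  mem_loose.2 ⟨(Finset.mem_sdiff.1 hc).1, P, .refl, (Finset.mem_sdiff.1 hc).2⟩

lemma Reach.mem_loose_of_isSwap {S C : Finset V} {P P' P'' : Finset (Finset V)} {Q : Finset V}
    {d c : V} (h : Reach G C P P') (hs : IsSwap G C P' P'' Q d c) (hP' : IsPacking G S P') :
    d ∈ loose G C P := by
  refine mem_loose.2 ⟨hs.2.2.1, P'', h.tail ⟨Q, d, c, hs⟩, ?_⟩
  rw [hs.covered_eq hP', Finset.mem_insert, not_or]
  refine ⟨?_, by simp⟩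
  rintro rfl
  exact (Finset.mem_sdiff.1 hs.2.2.2.1).2 (mem_covered.2 ⟨Q, hs.1, hs.2.1⟩)

/-- A vertex that does not distinguish uncovered vertices along swaps does not distinguish
loose vertices. -/
lemma adj_iff_of_mem_loose {S C : Finset V} {P : Finset (Finset V)} (hCS : C ⊆ S)
    (hP : IsSparse G S C P) {v : V}
    (hv : ∀ P', Reach G C P P' → ∀ c ∈ C \ covered P', ∀ c' ∈ C \ covered P',
      (G.Adj v c ↔ G.Adj v c')) :
    ∀ c ∈ loose G C P, ∀ c' ∈ loose G C P, (G.Adj v c ↔ G.Adj v c') := by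
  obtain ⟨c₀, hc₀⟩ : (C \ covered P).Nonempty := by
    have := hP.two_le
    exact Finset.card_pos.1 (by omega)
  have key : ∀ P', Reach G C P P' → ∀ c ∈ C \ covered P', (G.Adj v c ↔ G.Adj v c₀) := by
    intro P' h
    induction h with
    | refl => exact fun c hc => hv P .refl c hc c₀ hc₀
    | @tail P₁ P₂ h₁ hs ih =>
      intro a ha
      obtain ⟨Q, d, c, hs'⟩ := hs
      have h₁s := Reach.isSparse h₁ hCS hP
      -- A swap covers only one new vertex, and at least two were uncovered before it. So `P₁` and
      -- `P₂` leave a common vertex `b` of `C` uncovered, which carries the adjacency to `v` from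
      -- one packing to the next.
      obtain ⟨b, hb, hbc⟩ := Finset.exists_mem_ne (by have := h₁s.two_le; omega :
        1 < (C \ covered P₁).card) c
      have hb2 : b ∈ C \ covered P₂ := by
        rw [Finset.mem_sdiff] at hb ⊢
        refine ⟨hb.1, ?_⟩
        rw [hs'.covered_eq h₁s.isOptimal.1, Finset.mem_insert, not_or]
        exact ⟨hbc, fun h => hb.2 (Finset.mem_of_mem_erase h)⟩
      rw [hv P₂ (Relation.ReflTransGen.tail h₁ ⟨Q, d, c, hs'⟩) a ha b hb2]
      exact ih b hb
  intro c hc c' hc'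
  obtain ⟨hcC, P₁, h₁, hc⟩ := mem_loose.1 hc
  obtain ⟨hcC', P₂, h₂, hc'⟩ := mem_loose.1 hc'
  rw [key P₁ h₁ c (Finset.mem_sdiff.2 ⟨hcC, hc⟩), key P₂ h₂ c' (Finset.mem_sdiff.2 ⟨hcC', hc'⟩)]

/-- Every member of a packing can be followed along a sequence of swaps. -/
lemma Reach.exists_mem {S C : Finset V} {P P' : Finset (Finset V)} (h : Reach G C P P')
    (hCS : C ⊆ S) (hP : IsSparse G S C P) {Q : Finset V} (hQ : Q ∈ P) :
    ∃ Q' ∈ P', Q' \ C = Q \ C ∧ Q \ Q' ⊆ loose G C P := by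
  induction h with
  | refl => exact ⟨Q, hQ, rfl, by simp⟩
  | @tail P₁ P₂ h₁ hs ih =>
    obtain ⟨Q₁, hQ₁, he, hl⟩ := ih
    obtain ⟨B, d, c, hs⟩ := hs
    have hdl := Reach.mem_loose_of_isSwap h₁ hs (Reach.isSparse h₁ hCS hP).isOptimal.1
    obtain ⟨hB, hdB, hdC, hc, hsg, rfl⟩ := hs
    by_cases hQB : Q₁ = B
    · subst hQB
      refine ⟨_, Finset.mem_insert_self _ _, ?_, ?_⟩
      · rw [← he, Finset.insert_sdiff_of_mem _ (Finset.mem_sdiff.1 hc).1]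
        ext v
        simp only [Finset.mem_sdiff, Finset.mem_erase]
        grind
      · intro v hv
        simp only [Finset.mem_sdiff, Finset.mem_insert, Finset.mem_erase, not_or, not_and] at hv
        by_cases hvd : v = d
        · exact hvd ▸ hdl
        · exact hl (Finset.mem_sdiff.2 ⟨hv.1, hv.2.2 hvd⟩)
    · exact ⟨Q₁, Finset.mem_insert_of_mem (Finset.mem_erase.2 ⟨hQB, hQ₁⟩), he, hl⟩

/-- If `v` is covered, `IsOptimal.not_mixed` is applied to its own member. If not, any member with
at most one vertex in `C` can be sacrificed, and sparsity provides one. -/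
lemma IsSparse.adj_iff_of_uncovered {S C : Finset V} {P : Finset (Finset V)}
    (hP : IsSparse G S C P) (hC : ∀ x ∈ C, ∀ y ∈ C, x ≠ y → G.Adj x y) (hCS : C ⊆ S) {v : V}
    (hvS : v ∈ S) (hvC : v ∉ C) (hv : ∀ Q ∈ P, v ∈ Q → (Q ∩ C).card ≤ 1) {c c' : V}
    (hc : c ∈ C \ covered P) (hc' : c' ∈ C \ covered P) : G.Adj v c ↔ G.Adj v c' := by
  obtain ⟨hcC, hcP⟩ := Finset.mem_sdiff.1 hc
  obtain ⟨hcC', hcP'⟩ := Finset.mem_sdiff.1 hc'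
  have hcn : ∀ B ∈ P, c ∉ B := fun B hB h => hcP (mem_covered.2 ⟨B, hB, h⟩)
  have hcn' : ∀ B ∈ P, c' ∉ B := fun B hB h => hcP' (mem_covered.2 ⟨B, hB, h⟩)
  obtain ⟨Q, hQ, hcard, hvQ⟩ : ∃ Q ∈ P, (Q ∩ C).card ≤ 1 ∧ ∀ B ∈ P, B ≠ Q → v ∉ B := by
    by_cases h : ∃ Q ∈ P, v ∈ Q
    · obtain ⟨Q, hQ, hvQ⟩ := h
      exact ⟨Q, hQ, hv Q hQ hvQ, fun B hB hBQ hvB =>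
        Finset.disjoint_left.1 (hP.isOptimal.1.2 hB hQ hBQ) hvB hvQ⟩
    · obtain ⟨Q, hQ, hcard⟩ := hP.exists_card_le_one
      exact ⟨Q, hQ, hcard, fun B hB _ hvB => h ⟨B, hB, hvB⟩⟩
  exact ⟨hP.isOptimal.not_mixed hC hCS hvS hvC hcC hcC' hQ hcard (fun B hB _ => hcn B hB)
      (fun B hB _ => hcn' B hB) hvQ,
    hP.isOptimal.not_mixed hC hCS hvS hvC hcC' hcC hQ hcard (fun B hB _ => hcn' B hB)
      (fun B hB _ => hcn B hB) hvQ⟩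

/-- The other vertices of `Q` in `C` are adjacent to both `c` and `d`, as `C` is a clique, so only
those outside `C` have to be checked. -/
lemma IsOptimal.isSwap {S C : Finset V} {P : Finset (Finset V)} (hP : IsOptimal G S C P)
    (hC : ∀ x ∈ C, ∀ y ∈ C, x ≠ y → G.Adj x y) {Q : Finset V} (hQ : Q ∈ P) {d c : V} (hd : d ∈ Q)
    (hdC : d ∈ C) (hc : c ∈ C \ covered P)
    (h : ∀ p ∈ Q, p ∉ C → (G.Adj p c ↔ G.Adj p d)) :
    IsSwap G C P (insert (insert c (Q.erase d)) (P.erase Q)) Q d c := by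
  obtain ⟨hcC, hcP⟩ := Finset.mem_sdiff.1 hc
  have hcQ : c ∉ Q := fun h => hcP (mem_covered.2 ⟨Q, hQ, h⟩)
  refine ⟨hQ, hd, hdC, hc, (hP.1.1 Q hQ).1.swap hd hcQ fun p hp hpd => ?_, rfl⟩
  by_cases hpC : p ∈ C
  · have : p ≠ c := by rintro rfl; exact hcQ hp
    simp [hC p hpC c hcC this, hC p hpC d hdC hpd]
  · exact h p hp hpC

lemma IsSeagull.exists_notMem {Q C : Finset V} (hQ : IsSeagull G Q)
    (hC : ∀ x ∈ C, ∀ y ∈ C, x ≠ y → G.Adj x y) : ∃ v ∈ Q, v ∉ C := by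
  obtain ⟨x, z, y, hxy, hxz, hzy, hn, rfl⟩ := hQ
  by_contra! h
  exact hn (hC x (h x (by simp)) y (h y (by simp)) hxy)

lemma IsSeagull.eq_of_two_le {Q C : Finset V} (hQ : IsSeagull G Q) (h : 2 ≤ (Q ∩ C).card) {v : V}
    (hv : v ∈ Q) (hvC : v ∉ C) :
    ∃ a b, a ≠ b ∧ a ∈ C ∧ b ∈ C ∧ Q = {a, b, v} := by
  obtain ⟨a, ha, b, hb, hab⟩ := Finset.one_lt_card.1 (by omega : 1 < (Q ∩ C).card)
  rw [Finset.mem_inter] at ha hb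
  refine ⟨a, b, hab, ha.2, hb.2, (Finset.eq_of_subset_of_card_le ?_ ?_).symm⟩
  · intro t ht
    simp only [Finset.mem_insert, Finset.mem_singleton] at ht
    rcases ht with rfl | rfl | rfl
    exacts [ha.1, hb.1, hv]
  · rw [hQ.card]
    refine le_of_eq (Finset.card_eq_three.2 ⟨a, b, v, hab, ?_, ?_, rfl⟩).symm
    · rintro rfl; exact hvC ha.2
    · rintro rfl; exact hvC hb.2

/-- Every member of a sparse packing contains a loose vertex and another vertex which either is
loose or does not distinguish loose vertices. -/
lemma IsSparse.exists_pair (hG : NoIndepTriple G) {S C : Finset V} {P : Finset (Finset V)}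
    (hP : IsSparse G S C P) (hC : ∀ x ∈ C, ∀ y ∈ C, x ≠ y → G.Adj x y) (hCS : C ⊆ S)
    {Q : Finset V} (hQ : Q ∈ P) :
    ∃ d ∈ Q, ∃ e ∈ Q, d ≠ e ∧ d ∈ loose G C P ∧ (e ∈ loose G C P ∨ e ∉ C ∧
      ∀ c ∈ loose G C P, ∀ c' ∈ loose G C P, (G.Adj e c ↔ G.Adj e c')) := by
  have hQs := (hP.isOptimal.1.1 Q hQ).1
  obtain ⟨c₀, hc₀⟩ : (C \ covered P).Nonempty := by
    have := hP.two_le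
    exact Finset.card_pos.1 (by omega)
  obtain ⟨v, hvQ, hvC⟩ := hQs.exists_notMem hC
  have hvS : v ∈ S := (hP.isOptimal.1.1 Q hQ).2 hvQ
  by_cases hv : ∀ P', Reach G C P P' → ∀ c ∈ C \ covered P', ∀ c' ∈ C \ covered P',
      (G.Adj v c ↔ G.Adj v c')
  -- Here `v` does not distinguish loose vertices and serves as `e`. It remains to find a vertex of
  -- `Q` that can be swapped for `c₀`.
  · suffices ∃ d ∈ Q, d ∈ C ∧ ∀ p ∈ Q, p ∉ C → (G.Adj p c₀ ↔ G.Adj p d) by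
      obtain ⟨d, hdQ, hdC, hd⟩ := this
      have hs := hP.isOptimal.isSwap hC hQ hdQ hdC hc₀ hd
      refine ⟨d, hdQ, v, hvQ, by rintro rfl; exact hvC hdC,
        Reach.mem_loose_of_isSwap .refl hs hP.isOptimal.1,
        Or.inr ⟨hvC, adj_iff_of_mem_loose hCS hP hv⟩⟩
    rcases le_or_gt (Q ∩ C).card 1 with h1 | h1
    · obtain ⟨d, hd⟩ := hP.isOptimal.inter_nonempty hG hCS ⟨c₀, hc₀⟩ hQ
      obtain ⟨hdQ, hdC⟩ := Finset.mem_inter.1 hd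
      obtain ⟨hcC, hcP⟩ := Finset.mem_sdiff.1 hc₀
      have hcn : ∀ B ∈ P, B ≠ Q → c₀ ∉ B := fun B hB _ h => hcP (mem_covered.2 ⟨B, hB, h⟩)
      have hQn : ∀ t ∈ Q, ∀ B ∈ P, B ≠ Q → t ∉ B := fun t ht B hB hBQ htB =>
        Finset.disjoint_left.1 (hP.isOptimal.1.2 hB hQ hBQ) htB ht
      refine ⟨d, hdQ, hdC, fun p hp hpC => ?_⟩
      have hpS := (hP.isOptimal.1.1 Q hQ).2 hp
      exact ⟨hP.isOptimal.not_mixed hC hCS hpS hpC hcC hdC hQ h1 hcn (hQn d hdQ) (hQn p hp),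
        hP.isOptimal.not_mixed hC hCS hpS hpC hdC hcC hQ h1 (hQn d hdQ) hcn (hQn p hp)⟩
    -- Exactly one of `a`, `b` is adjacent to `v`, so one of them has the same adjacency to `v` as
    -- `c₀`.
    · obtain ⟨a, b, hab, ha, hb, rfl⟩ := hQs.eq_of_two_le h1 hvQ hvC
      have hiff := hQs.adj_iff_not_adj (a := a) (b := b) (v := v) (by simp) (by simp) (by simp)
        (by rintro rfl; exact hvC ha) (by rintro rfl; exact hvC hb) (hC a ha b hb hab)
      have hp : ∀ p ∈ ({a, b, v} : Finset V), p ∉ C → p = v := by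
        intro p hp hpC
        simp only [Finset.mem_insert, Finset.mem_singleton] at hp
        rcases hp with rfl | rfl | rfl
        exacts [(hpC ha).elim, (hpC hb).elim, rfl]
      by_cases h : G.Adj v c₀ ↔ G.Adj v a
      · exact ⟨a, by simp, ha, fun p hpQ hpC => by rw [hp p hpQ hpC]; exact h⟩
      · exact ⟨b, by simp, hb, fun p hpQ hpC => by rw [hp p hpQ hpC]; tauto⟩
  -- Now `v` distinguishes two vertices `c`, `c'` uncovered by some reachable `P'`. Optimality then
  -- forces the member of `P'` containing `v` to have two vertices in `C`, and each of these can be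
  -- swapped for `c` or for `c'`.
  · push Not at hv
    obtain ⟨P', hr, c, hc, c', hc', hcc'⟩ := hv
    have hP' := hr.isSparse hCS hP
    obtain ⟨Q', hQ', hvQ', h2⟩ : ∃ Q' ∈ P', v ∈ Q' ∧ 2 ≤ (Q' ∩ C).card := by
      by_contra! hcon
      have := hP'.adj_iff_of_uncovered hC hCS hvS hvC
        (fun B hB hvB => Nat.lt_succ_iff.1 (hcon B hB hvB)) hc hc'
      tauto
    obtain ⟨Q'', hQ'', he, hl⟩ := hr.exists_mem hCS hP hQ
    have hvQ'' : v ∈ Q'' := by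
      have : v ∈ Q'' \ C := by rw [he]; exact Finset.mem_sdiff.2 ⟨hvQ, hvC⟩
      exact (Finset.mem_sdiff.1 this).1
    obtain rfl : Q'' = Q' := by
      by_contra hne
      exact Finset.disjoint_left.1 (hP'.isOptimal.1.2 hQ'' hQ' hne) hvQ'' hvQ'
    have hQs' := (hP'.isOptimal.1.1 Q'' hQ').1
    obtain ⟨a, b, hab, ha, hb, hQe⟩ := hQs'.eq_of_two_le h2 hvQ' hvC
    have hiff := hQs'.adj_iff_not_adj (a := a) (b := b) (v := v) (by simp [hQe]) (by simp [hQe])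
      hvQ' (by rintro rfl; exact hvC ha) (by rintro rfl; exact hvC hb) (hC a ha b hb hab)
    have hp : ∀ p ∈ Q'', p ∉ C → p = v := by
      intro p hp hpC
      simp only [hQe, Finset.mem_insert, Finset.mem_singleton] at hp
      rcases hp with rfl | rfl | rfl
      exacts [(hpC ha).elim, (hpC hb).elim, rfl]
    have hloose : ∀ d ∈ Q'', d ∈ C → d ∈ loose G C P := by
      intro d hd hdC
      by_cases h : G.Adj v c ↔ G.Adj v d
      · exact Reach.mem_loose_of_isSwap hr (hP'.isOptimal.isSwap hC hQ' hd hdC hc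
          fun p hpQ hpC => by rw [hp p hpQ hpC]; exact h) hP'.isOptimal.1
      · exact Reach.mem_loose_of_isSwap hr (hP'.isOptimal.isSwap hC hQ' hd hdC hc'
          fun p hpQ hpC => by rw [hp p hpQ hpC]; tauto) hP'.isOptimal.1
    -- A vertex of `Q` in `C` either is still in `Q''` or was swapped out on the way; it is loose in
    -- both cases.
    have hloose' : ∀ d ∈ Q, d ∈ C → d ∈ loose G C P := by
      intro d hd hdC
      by_cases h : d ∈ Q''
      · exact hloose d h hdC
      · exact hl (Finset.mem_sdiff.2 ⟨hd, h⟩)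
    have hcard : (Q ∩ C).card = (Q'' ∩ C).card := by
      have h1 := Finset.card_sdiff_add_card_inter Q C
      have h2 := Finset.card_sdiff_add_card_inter Q'' C
      rw [hQs.card] at h1
      rw [hQs'.card, he] at h2
      omega
    obtain ⟨d, hd, e, he, hde⟩ := Finset.one_lt_card.1 (by omega : 1 < (Q ∩ C).card)
    rw [Finset.mem_inter] at hd he
    exact ⟨d, hd.1, e, he.1, hde, hloose' d hd.1 hd.2, Or.inl (hloose' e he.1 he.2)⟩

/-- Uncovered vertices outside `C` do not distinguish loose vertices. -/
lemma IsSparse.adj_iff_of_mem_loose {S C : Finset V} {P : Finset (Finset V)}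
    (hP : IsSparse G S C P) (hC : ∀ x ∈ C, ∀ y ∈ C, x ≠ y → G.Adj x y) (hCS : C ⊆ S) {v : V}
    (hvS : v ∈ S) (hvC : v ∉ C) (hvP : v ∉ covered P) :
    ∀ c ∈ loose G C P, ∀ c' ∈ loose G C P, (G.Adj v c ↔ G.Adj v c') := by
  refine SimpleGraph.adj_iff_of_mem_loose hCS hP fun P' hr c hc c' hc' => ?_
  refine (hr.isSparse hCS hP).adj_iff_of_uncovered hC hCS hvS hvC (fun Q hQ hvQ => ?_) hc hc'
  have h1 : v ∈ covered P' \ C := Finset.mem_sdiff.2 ⟨mem_covered.2 ⟨Q, hQ, hvQ⟩, hvC⟩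
  rw [hr.covered_sdiff hCS hP] at h1
  exact (hvP (Finset.mem_sdiff.1 h1).1).elim

/-! ### Vertex sets of size at least `2 (ℓ + r) - 1` -/

/-- A sparse packing that misses sufficiently many vertices of a clique of nonneighbours of `w`
yields a model. -/
lemma HasModel.of_isSparse (hG : NoIndepTriple G) {S C : Finset V} {P : Finset (Finset V)} {w : V}
    {ℓ r : ℕ} (hS : 2 * (ℓ + r) ≤ S.card + 1) (hw : w ∈ S)
    (hC : ∀ x ∈ C, ∀ y ∈ C, x ≠ y → G.Adj x y) (hCw : ∀ x ∈ C, ¬G.Adj w x)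
    (hCS : C ⊆ S.erase w) (hP : IsSparse G (S.erase w) C P)
    (hPℓ : P.card + 1 ≤ ℓ) (hC₀ : ℓ + r ≤ (C \ covered P).card + 2 * P.card) (hℓr : ℓ ≤ r) :
    HasModel G S ℓ r := by
  classical
  set T := loose G C P with hT
  set C₀ := C \ covered P with hC₀def
  have hpack := hP.isOptimal.1
  have hpackS : IsPacking G S P :=
    ⟨fun Q hQ => ⟨(hpack.1 Q hQ).1, (hpack.1 Q hQ).2.trans (Finset.erase_subset _ _)⟩, hpack.2⟩
  have hTC : T ⊆ C := fun x hx => (mem_loose.1 hx).1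
  have hC₀T : C₀ ⊆ T := sdiff_covered_subset_loose
  obtain ⟨c₁, hc₁⟩ : C₀.Nonempty := Finset.card_pos.1 (by have := hP.two_le; omega)
  have hc₁T := hC₀T hc₁
  have hCS' : C ⊆ S := hCS.trans (Finset.erase_subset _ _)
  have hwC : w ∉ C := fun h => (Finset.mem_erase.1 (hCS h)).1 rfl
  have : Nonempty V := ⟨w⟩
  choose! d hdQ e heQ hde hdT he using fun Q (hQ : Q ∈ P) => hP.exists_pair hG hC hCS hQ
  have huniq : ∀ Q ∈ P, ∀ Q' ∈ P, ∀ x, x ∈ Q → x ∈ Q' → Q = Q' := by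
    intro Q hQ Q' hQ' x hx hx'
    by_contra hne
    exact Finset.disjoint_left.1 (hpack.2 hQ hQ' hne) hx hx'
  have hdinj : Set.InjOn d (P : Set (Finset V)) := fun Q hQ Q' hQ' h =>
    huniq Q hQ Q' hQ' (d Q) (hdQ Q hQ) (h ▸ hdQ Q' hQ')
  have heinj : Set.InjOn e (P : Set (Finset V)) := fun Q hQ Q' hQ' h =>
    huniq Q hQ Q' hQ' (e Q) (heQ Q hQ) (h ▸ heQ Q' hQ')
  have hden : ∀ Q ∈ P, ∀ Q' ∈ P, d Q ≠ e Q' := by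
    intro Q hQ Q' hQ' h
    obtain rfl := huniq Q hQ Q' hQ' (d Q) (hdQ Q hQ) (h ▸ heQ Q' hQ')
    exact hde Q hQ h
  have hQS : ∀ Q ∈ P, ∀ x ∈ Q, x ∈ S := fun Q hQ x hx => (hpackS.1 Q hQ).2 hx
  have hcov : ∀ Q ∈ P, ∀ x ∈ Q, x ∈ covered P := fun Q hQ x hx => mem_covered.2 ⟨Q, hQ, hx⟩
  set F := (S.erase w \ C) \ covered P with hF
  have hFcard : 1 + C₀.card + F.card + 3 * P.card = S.card := by
    have h1 : C₀ ∪ F ∪ covered P = S.erase w := by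
      ext x
      have h1 := @hCS x
      have h2 : x ∈ covered P → x ∈ S.erase w := fun h => hpack.covered_subset h
      simp only [hC₀def, hF, Finset.mem_union, Finset.mem_sdiff]
      tauto
    have h2 : Disjoint C₀ F := Finset.disjoint_left.2 fun x hx hx' => by
      simp only [hC₀def, hF, Finset.mem_sdiff] at hx hx'
      tauto
    have h3 : Disjoint (C₀ ∪ F) (covered P) := Finset.disjoint_left.2 fun x hx hx' => by
      simp only [hC₀def, hF, Finset.mem_union, Finset.mem_sdiff] at hx
      tauto
    have h4 := congrArg Finset.card h1
    rw [Finset.card_union_of_disjoint h3, Finset.card_union_of_disjoint h2, hpack.card_covered,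
      ← Finset.card_erase_add_one hw] at *
    omega
  have hFhom : ∀ v ∈ F, ∀ c ∈ T, ∀ c' ∈ T, (G.Adj v c ↔ G.Adj v c') := by
    intro v hv
    simp only [hF, Finset.mem_sdiff] at hv
    exact hP.adj_iff_of_mem_loose hC hCS hv.1.1 hv.1.2 hv.2
  -- Vertices of `F` do not distinguish loose vertices, so testing against the single vertex `c₁`
  -- decides whether they are complete or anticomplete to `T`. The same test works for the vertices
  -- `e Q` outside `T`.
  set Fp := F.filter (fun v => G.Adj v c₁) with hFp
  set Fm := F.filter (fun v => ¬G.Adj v c₁) with hFm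
  have hFpm : Fp.card + Fm.card = F.card := Finset.card_filter_add_card_filter_not _
  set Pg := P.filter (fun Q => e Q ∈ T ∨ G.Adj (e Q) c₁) with hPg
  set Pm := P.filter (fun Q => ¬(e Q ∈ T ∨ G.Adj (e Q) c₁)) with hPm
  have hPgm : Pg.card + Pm.card = P.card := Finset.card_filter_add_card_filter_not _
  -- Keeping all seagulls gives `|C₀| + |Fp| + |P|` pieces, which is at least `2 (ℓ + r) - 2 - 2 |P|
  -- - |Fm|`. Breaking up a member of `Pg` into `d Q` and `e Q` gains one piece. The question is
  -- whether `Pg` is large enough to reach `ℓ + r`.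
  rcases le_or_gt (Fm.card + 2 * P.card + 2) (Pg.card + (ℓ + r)) with hcase | hcase
  · obtain ⟨Pb, hPb, hPbc⟩ : ∃ Pb ⊆ Pg, Pb.card = Fm.card + 2 * P.card + 2 - (ℓ + r) :=
      Finset.exists_subset_card_eq (by omega)
    have hPbP : Pb ⊆ P := hPb.trans (Finset.filter_subset _ _)
    set E₁ := (Pb.filter (fun Q => e Q ∈ T)).image e with hE₁
    set E₂ := (Pb.filter (fun Q => ¬e Q ∈ T)).image e with hE₂
    set D := Pb.image d with hD
    have hDc : D.card = Pb.card :=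
      Finset.card_image_of_injOn (hdinj.mono (by exact_mod_cast hPbP))
    have hEc : E₁.card + E₂.card = Pb.card := by
      rw [hE₁, hE₂, Finset.card_image_of_injOn, Finset.card_image_of_injOn]
      · exact Finset.card_filter_add_card_filter_not _
      · exact heinj.mono (by exact_mod_cast (Finset.filter_subset _ _).trans hPbP)
      · exact heinj.mono (by exact_mod_cast (Finset.filter_subset _ _).trans hPbP)
    have hDm : ∀ x ∈ D, ∃ Q ∈ Pb, x = d Q := fun x hx => by
      obtain ⟨Q, hQ, rfl⟩ := Finset.mem_image.1 hx
      exact ⟨Q, hQ, rfl⟩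
    have hE₁m : ∀ x ∈ E₁, ∃ Q ∈ Pb, x = e Q ∧ x ∈ T := fun x hx => by
      obtain ⟨Q, hQ, rfl⟩ := Finset.mem_image.1 hx
      exact ⟨Q, (Finset.mem_filter.1 hQ).1, rfl, (Finset.mem_filter.1 hQ).2⟩
    have hE₂m : ∀ x ∈ E₂, ∃ Q ∈ Pb, x = e Q ∧ x ∉ T := fun x hx => by
      obtain ⟨Q, hQ, rfl⟩ := Finset.mem_image.1 hx
      exact ⟨Q, (Finset.mem_filter.1 hQ).1, rfl, (Finset.mem_filter.1 hQ).2⟩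
    have hKT : C₀ ∪ D ∪ E₁ ⊆ T := by
      intro x hx
      rcases Finset.mem_union.1 hx with hx | hx
      · rcases Finset.mem_union.1 hx with hx | hx
        · exact hC₀T hx
        · obtain ⟨Q, hQ, rfl⟩ := hDm x hx
          exact hdT Q (hPbP hQ)
      · exact (hE₁m x hx).choose_spec.2.2
    have hC₀n : ∀ x ∈ C₀, x ∉ covered P := fun x hx => (Finset.mem_sdiff.1 hx).2
    have hKc : (C₀ ∪ D ∪ E₁).card = C₀.card + Pb.card + E₁.card := by
      rw [Finset.card_union_of_disjoint, Finset.card_union_of_disjoint, hDc]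
      · refine Finset.disjoint_left.2 fun x hx hx' => hC₀n x hx ?_
        obtain ⟨Q, hQ, rfl⟩ := hDm x hx'
        exact hcov Q (hPbP hQ) _ (hdQ Q (hPbP hQ))
      · refine Finset.disjoint_left.2 fun x hx hx' => ?_
        obtain ⟨Q, hQ, rfl, -⟩ := hE₁m x hx'
        rcases Finset.mem_union.1 hx with hx | hx
        · exact hC₀n _ hx (hcov Q (hPbP hQ) _ (heQ Q (hPbP hQ)))
        · obtain ⟨Q', hQ', h⟩ := hDm _ hx
          exact hden Q' (hPbP hQ') Q (hPbP hQ) h.symm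
    have hZc : (Fp ∪ E₂).card = Fp.card + E₂.card := by
      refine Finset.card_union_of_disjoint (Finset.disjoint_left.2 fun x hx hx' => ?_)
      obtain ⟨Q, hQ, rfl, -⟩ := hE₂m x hx'
      exact (Finset.mem_sdiff.1 (Finset.mem_filter.1 hx).1).2
        (hcov Q (hPbP hQ) _ (heQ Q (hPbP hQ)))
    have hrest : (P \ Pb).card + Pb.card = P.card := Finset.card_sdiff_add_card_eq_card hPbP
    have hsep : ∀ Q ∈ P \ Pb, ∀ x ∈ Q, x ∉ C₀ ∧ x ∉ D ∧ x ∉ E₁ ∧ x ∉ Fp ∧ x ∉ E₂ := by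
      intro Q hQ x hx
      obtain ⟨hQP, hQb⟩ := Finset.mem_sdiff.1 hQ
      refine ⟨fun h => hC₀n x h (hcov Q hQP x hx), fun h => ?_, fun h => ?_, fun h => ?_,
        fun h => ?_⟩
      · obtain ⟨Q', hQ', rfl⟩ := hDm x h
        exact hQb (huniq Q hQP Q' (hPbP hQ') _ hx (hdQ Q' (hPbP hQ')) ▸ hQ')
      · obtain ⟨Q', hQ', rfl, -⟩ := hE₁m x h
        exact hQb (huniq Q hQP Q' (hPbP hQ') _ hx (heQ Q' (hPbP hQ')) ▸ hQ')
      · exact (Finset.mem_sdiff.1 (Finset.mem_filter.1 h).1).2 (hcov Q hQP x hx)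
      · obtain ⟨Q', hQ', rfl, -⟩ := hE₂m x h
        exact hQb (huniq Q hQP Q' (hPbP hQ') _ hx (heQ Q' (hPbP hQ')) ▸ hQ')
    refine HasModel.of_clique hG (K := C₀ ∪ D ∪ E₁) (Z := Fp ∪ E₂) (P := P \ Pb)
      (hpackS.subset Finset.sdiff_subset) (hKT.trans (hTC.trans hCS')) ?_
      (fun x hx y hy => hC x (hTC (hKT hx)) y (hTC (hKT hy))) ?_ ?_ ?_ (by omega) (by omega)
    · intro x hx
      rcases Finset.mem_union.1 hx with hx | hx
      · exact Finset.mem_of_mem_erase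
          (Finset.mem_sdiff.1 (Finset.mem_sdiff.1 (Finset.mem_filter.1 hx).1).1).1
      · obtain ⟨Q, hQ, rfl, -⟩ := hE₂m x hx
        exact hQS Q (hPbP hQ) _ (heQ Q (hPbP hQ))
    · intro x hx y hy
      have hxT := hKT hx
      rcases Finset.mem_union.1 hy with hy | hy
      · obtain ⟨hyF, hy⟩ := Finset.mem_filter.1 hy
        exact ((hFhom y hyF x hxT c₁ hc₁T).2 hy).symm
      · obtain ⟨Q, hQ, rfl, hnT⟩ := hE₂m y hy
        have hadj : G.Adj (e Q) c₁ := (Finset.mem_filter.1 (hPb hQ)).2.resolve_left hnT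
        exact ((((he Q (hPbP hQ)).resolve_left hnT).2 x hxT c₁ hc₁T).2 hadj).symm
    · intro Q hQ
      refine Finset.disjoint_left.2 fun x hx hx' => ?_
      have := hsep Q hQ x hx
      simp only [Finset.mem_union] at hx'
      tauto
    · intro Q hQ
      refine Finset.disjoint_left.2 fun x hx hx' => ?_
      have := hsep Q hQ x hx
      simp only [Finset.mem_union] at hx'
      tauto
  -- With `Pg` too small, `w`, `Fm` and the vertices `e Q` for `Q ∈ Pm` are at least `ℓ + r - |P| >
  -- r` vertices anticomplete to `T`. They form a clique, since two nonadjacent ones and `c₁` would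
  -- be an independent triple. Also `|T| ≥ |C₀| + |P| ≥ ℓ + r - |P|`.
  · have hPmP : Pm ⊆ P := Finset.filter_subset _ _
    have hwn : w ∉ covered P := fun h => (Finset.mem_erase.1 (hpack.covered_subset h)).1 rfl
    have hEm : ∀ x ∈ Pm.image e, ∃ Q ∈ P, x = e Q ∧ e Q ∉ T ∧ ¬G.Adj (e Q) c₁ := fun x hx => by
      obtain ⟨Q, hQ, rfl⟩ := Finset.mem_image.1 hx
      have := (Finset.mem_filter.1 hQ).2
      rw [not_or] at this
      exact ⟨Q, hPmP hQ, rfl, this⟩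
    have hEc : (Pm.image e).card = Pm.card :=
      Finset.card_image_of_injOn (heinj.mono (by exact_mod_cast hPmP))
    have hYT : ∀ y ∈ insert w (Fm ∪ Pm.image e), y ∉ C ∧ ∀ x ∈ T, ¬G.Adj y x := by
      intro y hy
      rcases Finset.mem_insert.1 hy with rfl | hy
      · exact ⟨hwC, fun x hx => hCw x (hTC hx)⟩
      rcases Finset.mem_union.1 hy with hy | hy
      · obtain ⟨hyF, hyc⟩ := Finset.mem_filter.1 hy
        exact ⟨(Finset.mem_sdiff.1 (Finset.mem_sdiff.1 hyF).1).2,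
          fun x hx h => hyc ((hFhom y hyF x hx c₁ hc₁T).1 h)⟩
      · obtain ⟨Q, hQ, rfl, hnT, hn⟩ := hEm y hy
        have := (he Q hQ).resolve_left hnT
        exact ⟨this.1, fun x hx h => hn ((this.2 x hx c₁ hc₁T).1 h)⟩
    have hYS : insert w (Fm ∪ Pm.image e) ⊆ S := by
      intro y hy
      rcases Finset.mem_insert.1 hy with rfl | hy
      · exact hw
      rcases Finset.mem_union.1 hy with hy | hy
      · exact Finset.mem_of_mem_erase
          (Finset.mem_sdiff.1 (Finset.mem_sdiff.1 (Finset.mem_filter.1 hy).1).1).1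
      · obtain ⟨Q, hQ, rfl, -⟩ := hEm y hy
        exact hQS Q hQ _ (heQ Q hQ)
    have hYc : (insert w (Fm ∪ Pm.image e)).card = 1 + Fm.card + Pm.card := by
      rw [Finset.card_insert_of_notMem, Finset.card_union_of_disjoint, hEc]
      · omega
      · refine Finset.disjoint_left.2 fun x hx hx' => ?_
        obtain ⟨Q, hQ, rfl, -⟩ := hEm x hx'
        exact (Finset.mem_sdiff.1 (Finset.mem_filter.1 hx).1).2 (hcov Q hQ _ (heQ Q hQ))
      · intro h
        rcases Finset.mem_union.1 h with h | h
        · exact (Finset.mem_erase.1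
            (Finset.mem_sdiff.1 (Finset.mem_sdiff.1 (Finset.mem_filter.1 h).1).1).1).1 rfl
        · obtain ⟨Q, hQ, h, -⟩ := hEm w h
          exact hwn (h ▸ hcov Q hQ _ (heQ Q hQ))
    have hTc : C₀.card + P.card ≤ T.card := by
      rw [← Finset.card_image_of_injOn hdinj, ← Finset.card_union_of_disjoint]
      · refine Finset.card_le_card (Finset.union_subset hC₀T fun x hx => ?_)
        obtain ⟨Q, hQ, rfl⟩ := Finset.mem_image.1 hx
        exact hdT Q hQ
      · refine Finset.disjoint_left.2 fun x hx hx' => ?_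
        obtain ⟨Q, hQ, rfl⟩ := Finset.mem_image.1 hx'
        exact (Finset.mem_sdiff.1 hx).2 (hcov Q hQ _ (hdQ Q hQ))
    refine HasModel.of_two_cliques hG hS (hTC.trans hCS') hYS
      (fun x hx y hy => hC x (hTC hx) y (hTC hy)) ?_ ?_ (by omega) (by omega)
    · intro x hx y hy hxy
      obtain ⟨hxC, hxT⟩ := hYT x hx
      obtain ⟨hyC, hyT⟩ := hYT y hy
      have hc₁C := hTC hc₁T
      rcases hG x y c₁ hxy (by rintro rfl; exact hyC hc₁C) (by rintro rfl; exact hxC hc₁C)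
        with h | h | h
      exacts [h, (hyT c₁ hc₁T h).elim, (hxT c₁ hc₁T h).elim]
    · intro x hx y hy
      obtain ⟨hyC, hyT⟩ := hYT y hy
      exact ⟨by rintro rfl; exact hyC (hTC hx), fun h => hyT x hx h.symm⟩

/-- A graph without independent triples on at least `2 (ℓ + r) - 1` vertices has a model. -/
theorem HasModel.of_card (hG : NoIndepTriple G) {S : Finset V} {ℓ r : ℕ} (hℓ : 1 ≤ ℓ)
    (hℓr : ℓ ≤ r) (hS : 2 * (ℓ + r) ≤ S.card + 1) : HasModel G S ℓ r := by
  classical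
  -- The packing size is maximal subject to being at most `ℓ - 1`. The cap leaves a vertex `w`
  -- uncovered, as `3 (ℓ - 1) < 2 (ℓ + r) - 1`. Below the cap the packing is maximum in `S`.
  obtain ⟨k, hk, ⟨P₁, hP₁, hP₁c⟩, hmax⟩ : ∃ k, k + 1 ≤ ℓ ∧
      (∃ P, IsPacking G S P ∧ P.card = k) ∧
      (k + 1 < ℓ → ∀ P, IsPacking G S P → P.card ≠ k + 1) := by
    set p : ℕ → Prop := fun k => ∃ P, IsPacking G S P ∧ P.card = k with hp
    refine ⟨Nat.findGreatest p (ℓ - 1), ?_, ?_, ?_⟩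
    · have := Nat.findGreatest_le (P := p) (ℓ - 1)
      omega
    · exact Nat.findGreatest_spec (P := p) (Nat.zero_le _) ⟨∅, isPacking_empty S, rfl⟩
    · intro h P hP hc
      exact Nat.findGreatest_is_greatest (P := p) (Nat.lt_succ_self _) (by omega) ⟨P, hP, hc⟩
  obtain ⟨w, hw⟩ : (S \ covered P₁).Nonempty := by
    rw [← Finset.card_pos, Finset.card_sdiff_of_subset hP₁.covered_subset, hP₁.card_covered]
    omega
  obtain ⟨hwS, hwP₁⟩ := Finset.mem_sdiff.1 hw
  have hP₁w : IsPacking G (S.erase w) P₁ :=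
    ⟨fun Q hQ => ⟨(hP₁.1 Q hQ).1, fun x hx => Finset.mem_erase.2
      ⟨by rintro rfl; exact hwP₁ (mem_covered.2 ⟨Q, hQ, hx⟩), (hP₁.1 Q hQ).2 hx⟩⟩, hP₁.2⟩
  set C := (S.erase w).filter (fun x => ¬G.Adj w x) with hCdef
  have hCS : C ⊆ S.erase w := Finset.filter_subset _ _
  have hCS' : C ⊆ S := hCS.trans (Finset.erase_subset _ _)
  have hCw : ∀ x ∈ C, ¬G.Adj w x := fun x hx => (Finset.mem_filter.1 hx).2
  have hCne : ∀ x ∈ C, w ≠ x := fun x hx => (Finset.ne_of_mem_erase (hCS hx)).symm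
  have hC : ∀ x ∈ C, ∀ y ∈ C, x ≠ y → G.Adj x y := by
    intro x hx y hy hxy
    rcases hG w x y (hCne x hx) hxy (hCne y hy) with h | h | h
    exacts [(hCw x hx h).elim, h, (hCw y hy h).elim]
  obtain ⟨P, hopt, hPc⟩ : ∃ P, IsOptimal G (S.erase w) C P ∧ P.card = k := by
    set p : ℕ → Prop := fun n => ∃ P, IsPacking G (S.erase w) P ∧ P.card = k ∧ weight C P = n
      with hp
    have hle : ∀ P, IsPacking G (S.erase w) P → weight C P ≤ C.card := fun P hP => by
      have := card_sdiff_covered_add_weight hP.2 C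
      omega
    obtain ⟨P, hP, hPc, hPw⟩ := Nat.findGreatest_spec (P := p) (hle P₁ hP₁w) ⟨P₁, hP₁w, hP₁c, rfl⟩
    refine ⟨P, ⟨hP, fun P' hP' hc => ?_⟩, hPc⟩
    rw [hPw]
    exact Nat.le_findGreatest (hle P' hP') ⟨P', hP', hc.trans hPc, rfl⟩
  have hpack := hopt.1
  have hpackS : IsPacking G S P :=
    ⟨fun Q hQ => ⟨(hpack.1 Q hQ).1, (hpack.1 Q hQ).2.trans (Finset.erase_subset _ _)⟩, hpack.2⟩
  have hwn : w ∉ covered P := fun h => (Finset.mem_erase.1 (hpack.covered_subset h)).1 rfl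
  have hweight := card_sdiff_covered_add_weight hpack.2 C
  rcases le_or_gt (ℓ + r) ((C \ covered P).card + 2 * P.card) with hcase | hcase
  · rcases le_or_gt (ℓ + r) C.card with hCc | hCc
    · exact HasModel.of_clique hG (isPacking_empty S) hCS' (Finset.empty_subset S) hC (by simp)
        (by simp) (by simp) (by simp; omega) (by simpa using hCc)
    -- Sparsity is counting: at least `ℓ + r - 2k ≥ 2` vertices of `C` are uncovered, and `|C| < ℓ +
    -- r` leaves fewer than `2k` covered ones.
    · exact HasModel.of_isSparse hG hS hwS hC hCw hCS
        ⟨hopt, by omega, by omega⟩ (by omega) hcase hℓr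
  -- Since `|C \ covered P| + 2k < ℓ + r`, the count `hFc` yields `1 + |F| + k ≥ ℓ + r`: the vertex
  -- `w`, the set `F` and the seagulls are enough pieces.
  set F := ((S.erase w) \ covered P).filter (fun x => G.Adj w x) with hF
  have hFc : 1 + (C \ covered P).card + F.card + 3 * P.card = S.card := by
    have h1 : C \ covered P = ((S.erase w) \ covered P).filter (fun x => ¬G.Adj w x) := by
      ext x
      simp only [hCdef, Finset.mem_sdiff, Finset.mem_filter]
      tauto
    have h2 : F.card + (((S.erase w) \ covered P).filter (fun x => ¬G.Adj w x)).card =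
        ((S.erase w) \ covered P).card := by
      convert Finset.card_filter_add_card_filter_not (s := (S.erase w) \ covered P) _
    have h3 := Finset.card_sdiff_add_card_eq_card hpack.covered_subset
    have h4 := Finset.card_erase_add_one hwS
    rw [hpack.card_covered] at h3
    rw [h1]
    omega
  have hFS : F ⊆ S := (Finset.filter_subset _ _).trans
    (Finset.sdiff_subset.trans (Finset.erase_subset _ _))
  have hFn : ∀ x ∈ F, x ∉ covered P := fun x hx =>
    (Finset.mem_sdiff.1 (Finset.mem_filter.1 hx).1).2
  have hFw : ∀ x ∈ F, G.Adj w x := fun x hx => (Finset.mem_filter.1 hx).2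
  have hPw : ∀ Q ∈ P, w ∉ Q := fun Q hQ h => hwn (mem_covered.2 ⟨Q, hQ, h⟩)
  have hPF : ∀ Q ∈ P, Disjoint Q F := fun Q hQ =>
    Finset.disjoint_left.2 fun x hx hx' => hFn x hx' (mem_covered.2 ⟨Q, hQ, hx⟩)
  rcases (Nat.lt_or_ge (k + 1) ℓ) with hlt | hge
  -- Below the cap, two nonadjacent vertices of `F` would form with `w` a further disjoint seagull,
  -- so `F` is a clique and its vertices may go to either side.
  · refine HasModel.of_clique hG (K := insert w F) (Z := ∅) hpackS
      (Finset.insert_subset hwS hFS) (Finset.empty_subset S) ?_ (by simp)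
      (fun Q hQ => Finset.disjoint_insert_right.2 ⟨hPw Q hQ, hPF Q hQ⟩) (by simp) ?_ ?_
    · have hFF : ∀ x ∈ F, ∀ y ∈ F, x ≠ y → G.Adj x y := by
        intro x hx y hy hxy
        by_contra hn
        have hsub : ({x, w, y} : Finset V) ⊆ S := by
          intro t ht
          simp only [Finset.mem_insert, Finset.mem_singleton] at ht
          rcases ht with rfl | rfl | rfl
          exacts [hFS hx, hwS, hFS hy]
        have hsg : IsSeagull G {x, w, y} := ⟨x, w, y, hxy, (hFw x hx).symm, hFw y hy, hn, rfl⟩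
        have hd : ∀ B ∈ P, Disjoint B {x, w, y} := fun B hB => by
          simp only [Finset.disjoint_insert_right, Finset.disjoint_singleton_right]
          exact ⟨fun h => Finset.disjoint_left.1 (hPF B hB) h hx, hPw B hB,
            fun h => Finset.disjoint_left.1 (hPF B hB) h hy⟩
        have hnot : ({x, w, y} : Finset V) ∉ P := fun h => hPw _ h (by simp)
        refine hmax hlt (insert {x, w, y} P) ⟨?_, ?_⟩ ?_
        · intro B hB
          rcases Finset.mem_insert.1 hB with rfl | hB
          exacts [⟨hsg, hsub⟩, hpackS.1 B hB]
        · rw [Finset.coe_insert]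
          exact hpack.2.insert fun B hB _ => (hd B hB).symm
        · rw [Finset.card_insert_of_notMem hnot, hPc]
      intro x hx y hy hxy
      rcases Finset.mem_insert.1 hx with rfl | hx <;> rcases Finset.mem_insert.1 hy with rfl | hy
      exacts [(hxy rfl).elim, hFw y hy, (hFw x hx).symm, hFF x hx y hy hxy]
    · rw [Finset.card_insert_of_notMem (fun h => G.irrefl (hFw w h))]
      omega
    · rw [Finset.card_insert_of_notMem (fun h => G.irrefl (hFw w h)), Finset.card_empty]
      omega
  -- At the cap, `w` and the `ℓ - 1` seagulls already fill the left side, and `F` need only be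
  -- complete to `w`.
  · refine HasModel.of_clique hG (K := {w}) (Z := F) hpackS (by simpa using hwS) hFS (by simp)
      (by simpa using hFw) (fun Q hQ => by simpa using hPw Q hQ) hPF ?_ ?_
    · rw [Finset.card_singleton]; omega
    · rw [Finset.card_singleton]; omega

/-! ### Matchings in the complement and Gallai's lemma -/

/-- A matching in the complement of `G` on the vertex set `S`, as a family of disjoint pairs. -/
def IsAntimatching (G : SimpleGraph V) (S : Finset V) (M : Finset (Finset V)) : Prop :=
  (∀ p ∈ M, p ⊆ S ∧ ∃ u v, u ≠ v ∧ ¬G.Adj u v ∧ p = {u, v}) ∧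
    (M : Set (Finset V)).PairwiseDisjoint id

/-- A matching of maximum size in the complement of `G` on the vertex set `S`. -/
def IsMaxAntimatching (G : SimpleGraph V) (S : Finset V) (M : Finset (Finset V)) : Prop :=
  IsAntimatching G S M ∧ ∀ M', IsAntimatching G S M' → M'.card ≤ M.card

lemma isAntimatching_empty (S : Finset V) : IsAntimatching G S ∅ := by simp [IsAntimatching]

lemma IsAntimatching.covered_subset {S : Finset V} {M : Finset (Finset V)}
    (hM : IsAntimatching G S M) : covered M ⊆ S := by
  intro v hv
  obtain ⟨p, hp, hv⟩ := mem_covered.1 hv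
  exact (hM.1 p hp).1 hv

lemma IsAntimatching.card_covered {S : Finset V} {M : Finset (Finset V)}
    (hM : IsAntimatching G S M) : (covered M).card = 2 * M.card := by
  rw [covered, Finset.card_biUnion hM.2]
  refine (Finset.sum_congr rfl fun p hp => ?_).trans (by simp [mul_comm] : ∑ _p ∈ M, 2 = _)
  obtain ⟨-, u, v, huv, -, rfl⟩ := hM.1 p hp
  exact Finset.card_pair huv

lemma IsAntimatching.mono {S S' : Finset V} {M : Finset (Finset V)} (hM : IsAntimatching G S M)
    (hS : S ⊆ S') : IsAntimatching G S' M :=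
  ⟨fun p hp => ⟨(hM.1 p hp).1.trans hS, (hM.1 p hp).2⟩, hM.2⟩

lemma IsAntimatching.subset {S : Finset V} {M M' : Finset (Finset V)} (hM : IsAntimatching G S M)
    (h : M' ⊆ M) : IsAntimatching G S M' :=
  ⟨fun p hp => hM.1 p (h hp), hM.2.subset (by exact_mod_cast h)⟩

lemma IsAntimatching.not_adj {S : Finset V} {M : Finset (Finset V)} (hM : IsAntimatching G S M)
    {p : Finset V} (hp : p ∈ M) {x y : V} (hx : x ∈ p) (hy : y ∈ p) : ¬G.Adj x y := by
  obtain ⟨-, u, v, huv, hn, rfl⟩ := hM.1 p hp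
  have hn' : ¬G.Adj v u := fun h => hn h.symm
  simp only [Finset.mem_insert, Finset.mem_singleton] at hx hy
  rcases hx with rfl | rfl <;> rcases hy with rfl | rfl <;> simp [hn, hn']

lemma IsAntimatching.insert {S : Finset V} {M : Finset (Finset V)} (hM : IsAntimatching G S M)
    {u v : V} (huv : u ≠ v) (hn : ¬G.Adj u v) (hu : u ∈ S) (hv : v ∈ S) (huM : u ∉ covered M)
    (hvM : v ∉ covered M) :
    IsAntimatching G S (insert {u, v} M) ∧ (insert {u, v} M).card = M.card + 1 := by
  refine ⟨⟨?_, ?_⟩, Finset.card_insert_of_notMem fun h =>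
    huM (mem_covered.2 ⟨_, h, Finset.mem_insert_self _ _⟩)⟩
  · intro p hp
    rcases Finset.mem_insert.1 hp with rfl | hp
    · refine ⟨?_, u, v, huv, hn, rfl⟩
      intro t ht
      simp only [Finset.mem_insert, Finset.mem_singleton] at ht
      rcases ht with rfl | rfl <;> assumption
    · exact hM.1 p hp
  · rw [Finset.coe_insert]
    refine hM.2.insert fun p hp _ => ?_
    simp only [id, Finset.disjoint_insert_left, Finset.disjoint_singleton_left]
    exact ⟨fun h => huM (mem_covered.2 ⟨p, hp, h⟩), fun h => hvM (mem_covered.2 ⟨p, hp, h⟩)⟩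

lemma IsMaxAntimatching.adj {S : Finset V} {M : Finset (Finset V)} (hM : IsMaxAntimatching G S M)
    {u v : V} (huv : u ≠ v) (hu : u ∈ S) (hv : v ∈ S) (huM : u ∉ covered M)
    (hvM : v ∉ covered M) : G.Adj u v := by
  by_contra hn
  obtain ⟨h1, h2⟩ := hM.1.insert huv hn hu hv huM hvM
  have := hM.2 _ h1
  omega

lemma exists_isMaxAntimatching (G : SimpleGraph V) (S : Finset V) :
    ∃ M, IsMaxAntimatching G S M := by
  classical
  set p : ℕ → Prop := fun n => ∃ M, IsAntimatching G S M ∧ M.card = n with hp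
  have hle : ∀ M, IsAntimatching G S M → M.card ≤ S.card := fun M hM => by
    have := hM.card_covered
    have := Finset.card_le_card hM.covered_subset
    omega
  obtain ⟨M, hM, hMc⟩ := Nat.findGreatest_spec (P := p) (Nat.zero_le S.card)
    ⟨∅, isAntimatching_empty S, rfl⟩
  refine ⟨M, hM, fun M' hM' => ?_⟩
  rw [hMc]
  exact Nat.le_findGreatest (hle M' hM') ⟨M', hM', rfl⟩

/-- The vertices are equal, or no maximum matching of the complement misses both. -/
def MissedApart (G : SimpleGraph V) (S : Finset V) (u v : V) : Prop :=
  u = v ∨ ∀ M, IsMaxAntimatching G S M → u ∈ covered M ∨ v ∈ covered M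

/-- Gallai's lemma: if every vertex is missed by some maximum matching, then not being missed
by a common maximum matching is a transitive relation. -/
lemma MissedApart.trans {S : Finset V}
    (hS : ∀ x ∈ S, ∃ M, IsMaxAntimatching G S M ∧ x ∉ covered M) {u t v : V} (ht : t ∈ S)
    (h₁ : MissedApart G S u t) (h₂ : MissedApart G S t v) : MissedApart G S u v := by
  classical
  rcases h₁ with rfl | h₁
  · exact h₂
  rcases h₂ with rfl | h₂
  · exact Or.inr h₁
  by_contra hcon
  simp only [MissedApart, not_or, not_forall] at hcon
  obtain ⟨huv, M, hM, huM, hvM⟩ := hcon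
  have htM : t ∈ covered M := (h₁ M hM).resolve_left huM
  -- Among the maximum matchings missing `t`, take one sharing as many edges as possible with `M`. A
  -- further exchange towards `M` will contradict this choice.
  obtain ⟨N, hN, htN, hmax⟩ : ∃ N, IsMaxAntimatching G S N ∧ t ∉ covered N ∧
      ∀ N', IsMaxAntimatching G S N' → t ∉ covered N' → (M ∩ N').card ≤ (M ∩ N).card := by
    set p : ℕ → Prop := fun n => ∃ N, IsMaxAntimatching G S N ∧ t ∉ covered N ∧
      (M ∩ N).card = n with hp
    have hle : ∀ N, (M ∩ N).card ≤ M.card := fun N => Finset.card_le_card Finset.inter_subset_left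
    obtain ⟨N₀, hN₀, htN₀⟩ := hS t ht
    obtain ⟨N, hN, htN, hc⟩ := Nat.findGreatest_spec (P := p) (hle N₀) ⟨N₀, hN₀, htN₀, rfl⟩
    refine ⟨N, hN, htN, fun N' hN' htN' => ?_⟩
    rw [hc]
    exact Nat.le_findGreatest (hle N') ⟨N', hN', htN', rfl⟩
  have huN : u ∈ covered N := (h₁ N hN).resolve_right htN
  have hvN : v ∈ covered N := (h₂ N hN).resolve_left htN
  have hcard : (covered M).card = (covered N).card := by
    rw [hM.1.card_covered, hN.1.card_covered, le_antisymm (hN.2 _ hM.1) (hM.2 _ hN.1)]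
  have htwo : 1 < (covered M \ covered N).card := by
    rw [Finset.card_sdiff_comm hcard]
    have : ({u, v} : Finset V) ⊆ covered N \ covered M := by
      intro s hs
      simp only [Finset.mem_insert, Finset.mem_singleton] at hs
      rcases hs with rfl | rfl
      exacts [Finset.mem_sdiff.2 ⟨huN, huM⟩, Finset.mem_sdiff.2 ⟨hvN, hvM⟩]
    have := Finset.card_le_card this
    rw [Finset.card_pair huv] at this
    omega
  -- `N` covers `u` and `v`, which `M` misses, so by equal size `M` covers two vertices that `N`
  -- misses. One of these is not `t`, so its edge of `M` can be exchanged into `N` without covering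
  -- `t`.
  obtain ⟨x, hx, hxt⟩ := Finset.exists_mem_ne htwo t
  obtain ⟨hxM, hxN⟩ := Finset.mem_sdiff.1 hx
  obtain ⟨p, hpM, hxp⟩ := mem_covered.1 hxM
  obtain ⟨y, hxy, rfl⟩ : ∃ y, x ≠ y ∧ p = {x, y} := by
    obtain ⟨-, a, b, hab, -, rfl⟩ := hM.1.1 p hpM
    simp only [Finset.mem_insert, Finset.mem_singleton] at hxp
    rcases hxp with rfl | rfl
    · exact ⟨b, hab, rfl⟩
    · exact ⟨a, hab.symm, Finset.pair_comm _ _⟩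
  have hyp : y ∈ ({x, y} : Finset V) := by simp
  have hn := hM.1.not_adj hpM hxp hyp
  have hxS := (hM.1.1 _ hpM).1 hxp
  have hyS := (hM.1.1 _ hpM).1 hyp
  have hyN : y ∈ covered N := by
    by_contra hyN
    exact hn (hN.adj hxy hxS hyS hxN hyN)
  obtain ⟨q, hqN, hyq⟩ := mem_covered.1 hyN
  have hyN' : y ∉ covered (N.erase q) := by
    intro h
    obtain ⟨q', hq', hyq'⟩ := mem_covered.1 h
    rw [Finset.mem_erase] at hq'
    exact Finset.disjoint_left.1 (hN.1.2 hq'.2 hqN hq'.1) hyq' hyq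
  have hxN' : x ∉ covered (N.erase q) := by
    intro h
    obtain ⟨q', hq', hxq'⟩ := mem_covered.1 h
    exact hxN (mem_covered.2 ⟨q', Finset.mem_of_mem_erase hq', hxq'⟩)
  obtain ⟨h3, h4⟩ := (hN.1.subset (Finset.erase_subset q N)).insert hxy hn hxS hyS hxN' hyN'
  rw [Finset.card_erase_add_one hqN] at h4
  have htN' : t ∉ covered (insert {x, y} (N.erase q)) := by
    intro h
    obtain ⟨q', hq', htq'⟩ := mem_covered.1 h
    rcases Finset.mem_insert.1 hq' with rfl | hq'
    · simp only [Finset.mem_insert, Finset.mem_singleton] at htq'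
      rcases htq' with rfl | rfl
      exacts [hxt rfl, htN hyN]
    · exact htN (mem_covered.2 ⟨q', Finset.mem_of_mem_erase hq', htq'⟩)
  have h5 := hmax _ ⟨h3, fun M' hM' => h4 ▸ hN.2 M' hM'⟩ htN'
  have hqM : q ∉ M := by
    intro hqM
    have : ({x, y} : Finset V) = q := by
      by_contra hne
      exact Finset.disjoint_left.1 (hM.1.2 hpM hqM hne) hyp hyq
    exact hxN (mem_covered.2 ⟨q, hqN, this ▸ hxp⟩)
  have hpN : ({x, y} : Finset V) ∉ M ∩ N := fun h =>
    hxN (mem_covered.2 ⟨_, (Finset.mem_inter.1 h).2, hxp⟩)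
  have h6 : insert {x, y} (M ∩ N) ⊆ M ∩ insert {x, y} (N.erase q) := by
    intro s hs
    rcases Finset.mem_insert.1 hs with rfl | hs
    · exact Finset.mem_inter.2 ⟨hpM, Finset.mem_insert_self _ _⟩
    · rw [Finset.mem_inter] at hs
      exact Finset.mem_inter.2 ⟨hs.1, Finset.mem_insert_of_mem (Finset.mem_erase.2
        ⟨by rintro rfl; exact hqM hs.1, hs.2⟩)⟩
  have h7 := Finset.card_le_card h6
  rw [Finset.card_insert_of_notMem hpN] at h7
  omega

/-- If no matching of the complement of `G` on `S` has more than `|S| - (ℓ + r)` edges, then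
there is a model in `S`. -/
theorem HasModel.of_antimatching (hG : NoIndepTriple G) (S : Finset V) (ℓ r : ℕ)
    (hS : ∀ M, IsAntimatching G S M → ℓ + r + M.card ≤ S.card) : HasModel G S ℓ r := by
  classical
  induction hn : S.card using Nat.strong_induction_on generalizing S ℓ r with
  | _ n ih =>
  subst hn
  by_cases hdel : ∃ v ∈ S, ∀ M, IsAntimatching G (S.erase v) M → ℓ + r + M.card ≤ (S.erase v).card
  · obtain ⟨v, hv, h⟩ := hdel
    exact (ih _ (Finset.card_erase_lt_of_mem hv) _ ℓ r h rfl).mono (Finset.erase_subset _ _)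
  -- If every maximum matching covered `x`, the matchings of `S.erase x` would all be smaller than
  -- maximum, and the hypothesis would survive deleting `x`.
  have hmiss : ∀ x ∈ S, ∃ M, IsMaxAntimatching G S M ∧ x ∉ covered M := by
    intro x hx
    by_contra! hcon
    refine hdel ⟨x, hx, fun M hM => ?_⟩
    have hxM : x ∉ covered M := fun h => by simpa using hM.covered_subset h
    have hMS := hM.mono (Finset.erase_subset x S)
    have hnot : ¬IsMaxAntimatching G S M := fun h => hxM (hcon M h)
    simp only [IsMaxAntimatching, hMS, true_and, not_forall, not_le] at hnot
    obtain ⟨M', hM', hlt⟩ := hnot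
    have := hS M' hM'
    have := Finset.card_erase_add_one hx
    omega
  by_cases hsep : ∃ u ∈ S, ∃ v ∈ S, ¬MissedApart G S u v
  · obtain ⟨u, hu, v, hv, huv⟩ := hsep
    set X := S.filter (fun x => MissedApart G S u x) with hX
    set Y := S.filter (fun x => ¬MissedApart G S u x) with hY
    have huX : u ∈ X := Finset.mem_filter.2 ⟨hu, Or.inl rfl⟩
    have hvY : v ∈ Y := Finset.mem_filter.2 ⟨hv, huv⟩
    -- Vertices in different classes are missed together by some maximum matching, which could be
    -- enlarged if they were nonadjacent in `G`.
    have hXY : ∀ x ∈ X, ∀ y ∈ Y, G.Adj x y := by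
      intro x hx y hy
      obtain ⟨hxS, hx⟩ := Finset.mem_filter.1 hx
      obtain ⟨hyS, hy⟩ := Finset.mem_filter.1 hy
      have hxy : ¬MissedApart G S x y := fun h => hy (hx.trans hmiss hxS h)
      simp only [MissedApart, not_or, not_forall] at hxy
      obtain ⟨hne, M, hM, hxM, hyM⟩ := hxy
      exact hM.adj hne hxS hyS hxM hyM
    have hXS : X ⊆ S := Finset.filter_subset _ _
    have hYS : Y ⊆ S := Finset.filter_subset _ _
    have hd : Disjoint X Y := Finset.disjoint_filter_filter_not _ _ _
    have hU : X ∪ Y = S := Finset.filter_union_filter_not_eq _ _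
    have hc : X.card + Y.card = S.card := by rw [← Finset.card_union_of_disjoint hd, hU]
    have hXpos : 0 < X.card := Finset.card_pos.2 ⟨u, huX⟩
    have hYpos : 0 < Y.card := Finset.card_pos.2 ⟨v, hvY⟩
    obtain ⟨A, hA⟩ := exists_isMaxAntimatching G X
    obtain ⟨B, hB⟩ := exists_isMaxAntimatching G Y
    have hAB : Disjoint A B := by
      refine Finset.disjoint_left.2 fun p hp hp' => ?_
      obtain ⟨hpX, a, b, -, -, rfl⟩ := hA.1.1 p hp
      exact Finset.disjoint_left.1 hd (hpX (Finset.mem_insert_self _ _))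
        ((hB.1.1 _ hp').1 (Finset.mem_insert_self _ _))
    have hunion : IsAntimatching G S (A ∪ B) := by
      refine ⟨fun p hp => ?_, fun p hp q hq hpq => ?_⟩
      · rcases Finset.mem_union.1 hp with hp | hp
        exacts [(hA.1.mono hXS).1 p hp, (hB.1.mono hYS).1 p hp]
      · rcases Finset.mem_union.1 (Finset.mem_coe.1 hp) with hp | hp <;>
          rcases Finset.mem_union.1 (Finset.mem_coe.1 hq) with hq | hq
        · exact hA.1.2 hp hq hpq
        · exact Finset.disjoint_of_subset_left (hA.1.1 p hp).1
            (Finset.disjoint_of_subset_right (hB.1.1 q hq).1 hd)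
        · exact Finset.disjoint_of_subset_left (hB.1.1 p hp).1
            (Finset.disjoint_of_subset_right (hA.1.1 q hq).1 hd.symm)
        · exact hB.1.2 hp hq hpq
    have hAc := Finset.card_le_card hA.1.covered_subset
    have hBc := Finset.card_le_card hB.1.covered_subset
    rw [hA.1.card_covered] at hAc
    rw [hB.1.card_covered] at hBc
    have htot := hS _ hunion
    rw [Finset.card_union_of_disjoint hAB] at htot
    -- The union of the two maximum matchings gives `ℓ + r ≤ (|X| - |A|) + (|Y| - |B|)`. The
    -- capacity of `X` is filled greedily, first from `ℓ` and then from `r`.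
    obtain ⟨a, b, c, d, hac, hbd, hab, hcd⟩ : ∃ a b c d, a + c = ℓ ∧ b + d = r ∧
        a + b + A.card ≤ X.card ∧ c + d + B.card ≤ Y.card := by
      refine ⟨min ℓ (X.card - A.card), min r (X.card - A.card - min ℓ (X.card - A.card)),
        ℓ - min ℓ (X.card - A.card),
        r - min r (X.card - A.card - min ℓ (X.card - A.card)), ?_, ?_, ?_, ?_⟩ <;> omega
    have h1 := ih X.card (by omega) X a b
      (fun M hM => by have := hA.2 M hM; omega) rfl
    have h2 := ih Y.card (by omega) Y c d
      (fun M hM => by have := hB.2 M hM; omega) rfl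
    have := h1.join hXY h2
    rwa [hU, hac, hbd] at this
  · push Not at hsep
    have h0 := hS ∅ (isAntimatching_empty S)
    rw [Finset.card_empty] at h0
    have hzero : ∀ s, s ≤ S.card → HasModel G S 0 s := fun s hs =>
      HasModel.of_clique hG (K := ∅) (Z := S) (isPacking_empty S) (Finset.empty_subset S)
        subset_rfl (by simp) (by simp) (by simp) (by simp) (Nat.zero_le _) (by simpa using hs)
    obtain ⟨M, hM⟩ := exists_isMaxAntimatching G S
    -- With a single class, no maximum matching misses two vertices. Hence `2 |M| ≥ |S| - 1`, and `ℓ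
    -- + r + |M| ≤ |S|` turns into `2 (ℓ + r) ≤ |S| + 1`.
    have hle : (S \ covered M).card ≤ 1 := by
      refine Finset.card_le_one.2 fun x hx y hy => ?_
      rw [Finset.mem_sdiff] at hx hy
      rcases hsep x hx.1 y hy.1 with h | h
      · exact h
      · rcases h M hM with h | h
        exacts [(hx.2 h).elim, (hy.2 h).elim]
    have hsum := Finset.card_sdiff_add_card_eq_card hM.1.covered_subset
    rw [hM.1.card_covered] at hsum
    have hb := hS M hM.1
    rcases Nat.eq_zero_or_pos ℓ with rfl | hℓ
    · exact hzero r (by omega)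
    rcases Nat.eq_zero_or_pos r with rfl | hr
    · exact (hzero ℓ (by omega)).symm
    rcases le_total ℓ r with h | h
    · exact HasModel.of_card hG hℓ h (by omega)
    · exact (HasModel.of_card hG hr h (by omega)).symm

/-! ### Colourings from matchings, and the conclusion -/

/-- A matching in the complement gives a colouring whose classes are its edges and the remaining
single vertices. -/
lemma IsAntimatching.colorable [Fintype V] {M : Finset (Finset V)}
    (hM : IsAntimatching G Finset.univ M) : G.Colorable (Fintype.card V - M.card) := by
  classical
  have hex : ∀ v, ∃ p : Finset V, v ∈ p ∧ (p ∈ M ∨ v ∉ covered M ∧ p = {v}) := by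
    intro v
    by_cases h : v ∈ covered M
    · obtain ⟨p, hp, hv⟩ := mem_covered.1 h
      exact ⟨p, hv, Or.inl hp⟩
    · exact ⟨{v}, by simp, Or.inr ⟨h, rfl⟩⟩
  choose f hf hfM using hex
  set D := Finset.univ.image f with hD
  have hDsub : D ⊆ M ∪ (Finset.univ \ covered M).image (fun x => ({x} : Finset V)) := by
    intro p hp
    obtain ⟨v, -, rfl⟩ := Finset.mem_image.1 hp
    rcases hfM v with h | ⟨h, he⟩
    · exact Finset.mem_union_left _ h
    · exact Finset.mem_union_right _ (Finset.mem_image.2 ⟨v, by simp [h], he.symm⟩)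
  have hDc : D.card ≤ Fintype.card V - M.card := by
    have h1 := (Finset.card_le_card hDsub).trans (Finset.card_union_le _ _)
    rw [singleton_image_card] at h1
    have h2 := Finset.card_sdiff_add_card_eq_card (Finset.subset_univ (covered M))
    rw [hM.card_covered, Finset.card_univ] at h2
    omega
  have hcol : G.Coloring D := Coloring.mk
    (fun v => ⟨f v, Finset.mem_image_of_mem _ (Finset.mem_univ v)⟩) (by
      intro u v huv h
      have h' : f u = f v := congrArg Subtype.val h
      rcases hfM u with hu | ⟨-, hu⟩
      · exact hM.not_adj hu (hf u) (h' ▸ hf v) huv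
      · have : v ∈ f u := h' ▸ hf v
        rw [hu, Finset.mem_singleton] at this
        exact huv.ne this.symm)
  have := hcol.colorable
  rw [Fintype.card_coe] at this
  exact this.mono hDc

lemma noIndepTriple_of_indepNum [Finite V] (h : G.indepNum ≤ 2) : NoIndepTriple G := by
  intro x y z hxy hyz hxz
  by_contra! hcon
  obtain ⟨h1, h2, h3⟩ := hcon
  have h1' : ¬G.Adj y x := fun h => h1 h.symm
  have h2' : ¬G.Adj z y := fun h => h2 h.symm
  have h3' : ¬G.Adj z x := fun h => h3 h.symm
  have hind : G.IsIndepSet (({x, y, z} : Finset V) : Set V) := by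
    intro a ha b hb _
    simp only [Finset.coe_insert, Finset.coe_singleton, Set.mem_insert_iff,
      Set.mem_singleton_iff] at ha hb
    rcases ha with rfl | rfl | rfl <;> rcases hb with rfl | rfl | rfl <;> simp [*]
  have := hind.card_le_indepNum
  rw [Finset.card_eq_three.2 ⟨x, y, z, hxy, hxz, hyz, rfl⟩] at this
  omega

end SimpleGraph

theorem theorem4 {V : Type*} [Finite V] (G : SimpleGraph V) (hα : G.indepNum = 2)
    (χ : ℕ) (hχ : G.chromaticNumber = χ) (ℓ : ℕ) (hℓ : 0 < ℓ) (hlt : ℓ < χ) :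
    ∃ M : SimpleGraph.Model (completeBipartiteGraph (Fin ℓ) (Fin (χ - ℓ))) G,
      M.IsSpecialOdd := by
  classical
  have := Fintype.ofFinite V
  refine SimpleGraph.HasModel.exists_isSpecialOdd (SimpleGraph.HasModel.of_antimatching
    (SimpleGraph.noIndepTriple_of_indepNum hα.le) _ _ _ fun M hM => ?_)
  have h := hM.colorable.chromaticNumber_le
  rw [hχ] at h
  have h' : χ ≤ Fintype.card V - M.card := by exact_mod_cast h
  rw [Finset.card_univ]
  -- The truncated subtraction in `h'` is harmless: `χ > 0` forces `M.card < Fintype.card V`.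
  omega
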